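/- Let $F$ be a field of characteristic different from $2$ and let $Q$ be a quaternion division algebra over $F$, with canonical involution $x\mapsto\overline{x}$ and reduced norm $\operatorname{Nrd}_Q(x)=x\overline{x}$. Write $(a,b)_F$ for the quaternion algebra over $F$ with generators $i,j$ and relations $i^2=a$, $j^2=b$, $ji=-ij$. Let $q_1,q_2,q_3\in Q$ be pure quaternions (elements of trace zero) with squares $q_i^2=a_i\in F^\times$, and assume that (1) $Q$ is split by $F(\sqrt{a_1a_2a_3})$; (2) there is no $\mu\in F^\times$ such that $Q\simeq(a_1,\mu)_F\simeq(a_2,\mu)_F\simeq(a_3,\mu)_F$. Let $n\ge 3$ be odd, put $q_i=q_3$ for $4\le i\le n$, let $\widehat F=F((t_1))\cdots((t_n))$ be the field of iterated Laurent series in $n$ indeterminates, $\widehat Q=Q\otimes_F\widehat F$, $A=M_n(\widehat Q)$, and let $\sigma$ be the orthogonal involution on $A$ adjoint to the skew-hermitian form $\langle t_1q_1,\ldots,t_nq_n\rangle$ over $(\widehat Q,\overline{\phantom{x}})$, i.e. to $h(x,y)=\sum_i \overline{x_i}\,t_iq_i\,y_i$ on the right $\widehat Q$-space $\widehat Q^n$.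 A similitude of $(A,\sigma)$ is an element $g\in A^\times$ with $\mu(g)=\sigma(g)g\in\widehat F^\times$; it is improper if $\operatorname{Nrd}_A(g)=-\mu(g)^n$, and square-central if $g^2\in\widehat F^\times$. The discriminant of $\sigma$ is the class $\operatorname{disc}\sigma=(-1)^n\operatorname{Nrd}_A(x)\cdot\widehat F^{\times2}$ for any $x\in A^\times$ with $\sigma(x)=-x$. Then: (a) $(A,\sigma)$ has no square-central improper similitude; (b) $\operatorname{disc}\sigma=a_1a_2a_3\cdot\widehat F^{\times 2}$, this class is not trivial, and the discriminant quadratic extension $Z=\widehat F(\sqrt{\operatorname{disc}\sigma})$ splits $\widehat Q$; (c) if moreover $-1\notin\operatorname{Nrd}_Q(Q^\times)$, then $(A,\sigma)$ has no improper similitude at all. -/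

import Mathlib

open scoped Quaternion TensorProduct Matrix

universe u v

/-! ## Quaternion algebras, extension of scalars, splitting

`ℍ[F, α, β]` is the quaternion algebra `(α, β)_F`: generators `i`, `j` with
`i² = α`, `j² = β`, `ji = -ij`.  Its canonical involution is `star`, its reduced norm is
`x ↦ x * star x` and its pure quaternions are the elements with `re = 0`. -/

/-- `(α, β)_F` with scalars extended to the `F`-algebra `L`, i.e. the algebra `(α, β)_L`. -/
abbrev QuatExt {F : Type u} [CommRing F] (L : Type v) [CommRing L] [Algebra F L] (α β : F) :
    Type v :=
  ℍ[L, algebraMap F L α, algebraMap F L β]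

/-- The canonical map `Q → Q ⊗ L`, in coordinates. -/
def quatExtMap {F : Type u} [CommRing F] (L : Type v) [CommRing L] [Algebra F L] (α β : F)
    (x : ℍ[F, α, β]) : QuatExt L α β :=
  ⟨algebraMap F L x.re, algebraMap F L x.imI, algebraMap F L x.imJ, algebraMap F L x.imK⟩

/-- `(α, β)_L` is an extension of scalars of `(α, β)_F`, and `quatExtMap` is the canonical map. -/
theorem quatExt_baseChange {F : Type u} [CommRing F] (L : Type v) [CommRing L] [Algebra F L]
    (α β : F) :
    ∃ e : L ⊗[F] ℍ[F, α, β] ≃ₐ[L] QuatExt L α β, ∀ x, e (1 ⊗ₜ[F] x) = quatExtMap L α β x := by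
  let bF : QuaternionAlgebra.Basis (QuatExt L α β) α 0 β :=
    { i := ⟨0, 1, 0, 0⟩
      j := ⟨0, 0, 1, 0⟩
      k := ⟨0, 0, 0, 1⟩
      i_mul_i := by ext <;> simp [Algebra.algebraMap_eq_smul_one]
      j_mul_j := by ext <;> simp [Algebra.algebraMap_eq_smul_one]
      i_mul_j := by ext <;> simp
      j_mul_i := by ext <;> simp }
  let bL : QuaternionAlgebra.Basis (L ⊗[F] ℍ[F, α, β]) (algebraMap F L α) 0 (algebraMap F L β) :=
    { i := 1 ⊗ₜ ⟨0, 1, 0, 0⟩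
      j := 1 ⊗ₜ ⟨0, 0, 1, 0⟩
      k := 1 ⊗ₜ ⟨0, 0, 0, 1⟩
      i_mul_i := by
        have h : (⟨0, 1, 0, 0⟩ : ℍ[F, α, β]) * ⟨0, 1, 0, 0⟩ = α • 1 := by ext <;> simp
        simp [h, Algebra.TensorProduct.one_def]
      j_mul_j := by
        have h : (⟨0, 0, 1, 0⟩ : ℍ[F, α, β]) * ⟨0, 0, 1, 0⟩ = β • 1 := by ext <;> simp
        simp [h, Algebra.TensorProduct.one_def]
      i_mul_j := by simp
      j_mul_i := by
        have h : (⟨0, 0, 1, 0⟩ : ℍ[F, α, β]) * ⟨0, 1, 0, 0⟩ = -⟨0, 0, 0, 1⟩ := by ext <;> simp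
        rw [Algebra.TensorProduct.tmul_mul_tmul, h, TensorProduct.tmul_neg]; simp }
  have hc : ∀ (x : L) (y : ℍ[F, α, β]),
      Commute (Algebra.ofId L (QuatExt L α β) x) (bF.liftHom y) :=
    fun x y => Algebra.commutes x (bF.liftHom y)
  let f : L ⊗[F] ℍ[F, α, β] →ₐ[L] QuatExt L α β :=
    Algebra.TensorProduct.lift (Algebra.ofId L _) bF.liftHom hc
  let g : QuatExt L α β →ₐ[L] L ⊗[F] ℍ[F, α, β] := bL.liftHom
  have hf : ∀ x, f (1 ⊗ₜ[F] x) = quatExtMap L α β x := by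
    intro x
    have h1 : f (1 ⊗ₜ[F] x) = bF.lift x := by
      change Algebra.TensorProduct.lift (Algebra.ofId L _) bF.liftHom hc (1 ⊗ₜ[F] x) = _
      rw [Algebra.TensorProduct.lift_tmul, map_one, one_mul]; rfl
    rw [h1]
    ext <;> simp [bF, quatExtMap, QuaternionAlgebra.Basis.lift,
      Algebra.algebraMap_eq_smul_one]
  have hfg : f.comp g = AlgHom.id L _ := by
    apply QuaternionAlgebra.hom_ext
    · change f (g ⟨0, 1, 0, 0⟩) = ⟨0, 1, 0, 0⟩
      have : g ⟨0, 1, 0, 0⟩ = 1 ⊗ₜ ⟨0, 1, 0, 0⟩ := by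
        simp [g, bL, QuaternionAlgebra.Basis.lift]
      rw [this, hf]; ext <;> simp [quatExtMap]
    · change f (g ⟨0, 0, 1, 0⟩) = ⟨0, 0, 1, 0⟩
      have : g ⟨0, 0, 1, 0⟩ = 1 ⊗ₜ ⟨0, 0, 1, 0⟩ := by
        simp [g, bL, QuaternionAlgebra.Basis.lift]
      rw [this, hf]; ext <;> simp [quatExtMap]
  have hgf : g.comp f = AlgHom.id L _ := by
    apply Algebra.TensorProduct.ext
    · ext
    · apply QuaternionAlgebra.hom_ext
      · change g (f (1 ⊗ₜ ⟨0, 1, 0, 0⟩)) = 1 ⊗ₜ ⟨0, 1, 0, 0⟩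
        rw [hf]; simp [g, bL, QuaternionAlgebra.Basis.lift, quatExtMap]
      · change g (f (1 ⊗ₜ ⟨0, 0, 1, 0⟩)) = 1 ⊗ₜ ⟨0, 0, 1, 0⟩
        rw [hf]; simp [g, bL, QuaternionAlgebra.Basis.lift, quatExtMap]
  exact ⟨AlgEquiv.ofAlgHom f g hfg hgf, hf⟩

/-- `Q` is a division algebra. -/
def IsDivisionAlg (Q : Type u) [Ring Q] : Prop := Nontrivial Q ∧ ∀ x : Q, x ≠ 0 → IsUnit x

/-- The degree 2 algebra `Q` over the field `K` is split by `K(√d) = K[X]/(X² - d)`: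
`K(√d) ⊗ Q ≅ M₂(K(√d))` as `K(√d)`-algebras. -/
def IsSplitBySqrt (K : Type u) [Field K] (Q : Type u) [Ring Q] [Algebra K Q] (d : K) : Prop :=
  Nonempty (QuadraticAlgebra K d 0 ⊗[K] Q ≃ₐ[QuadraticAlgebra K d 0]
    Matrix (Fin 2) (Fin 2) (QuadraticAlgebra K d 0))

/-! ## The reduced norm of `M_n(Q)` -/

/-- The matrices `i ↦ diag(√a, -√a)`, `j ↦ (0 b; 1 0)` over `K(√a)`, which satisfy the relations
of `(a, b)_K`. -/
def splitBasis {K : Type u} [Field K] (a b : K) :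
    QuaternionAlgebra.Basis (Matrix (Fin 2) (Fin 2) (QuadraticAlgebra K a 0)) a 0 b where
  i := !![⟨0, 1⟩, 0; 0, ⟨0, -1⟩]
  j := !![0, ⟨b, 0⟩; 1, 0]
  k := !![0, ⟨0, b⟩; ⟨0, -1⟩, 0]
  i_mul_i := by
    ext i j <;> fin_cases i <;> fin_cases j <;> simp [QuadraticAlgebra.re_one, QuadraticAlgebra.im_one]
  j_mul_j := by
    ext i j <;> fin_cases i <;> fin_cases j <;> simp [QuadraticAlgebra.re_one, QuadraticAlgebra.im_one]
  i_mul_j := by ext i j <;> fin_cases i <;> fin_cases j <;> simp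
  j_mul_i := by ext i j <;> fin_cases i <;> fin_cases j <;> simp

/-- The standard representation of `(a, b)_K` by `2 × 2` matrices over its splitting algebra
`K(√a)`. -/
def splitHom {K : Type u} [Field K] (a b : K) :
    ℍ[K, a, b] →ₐ[K] Matrix (Fin 2) (Fin 2) (QuadraticAlgebra K a 0) :=
  (splitBasis a b).liftHom

/-- The reduced norm of a matrix over `(a, b)_K`: the determinant of its image in
`M_n(M₂(K(√a))) = M_{2n}(K(√a))`.  (The value lies in `K`; it is recorded in `K(√a)`.) -/
def reducedNorm {K : Type u} [Field K] {a b : K} {n : ℕ} (M : Matrix (Fin n) (Fin n) ℍ[K, a, b]) :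
    QuadraticAlgebra K a 0 :=
  (Matrix.comp (Fin n) (Fin n) (Fin 2) (Fin 2) _ (M.map (splitHom a b))).det

/-! ## Skew-hermitian forms `⟨u₁, …, uₙ⟩` and adjoint involutions -/

/-- The form `⟨u₁, …, uₙ⟩` on the right module `Qⁿ`, with respect to the canonical involution:
`h(x, y) = ∑ x̄ᵢ uᵢ yᵢ`. -/
def diagForm {Q : Type u} [Ring Q] [StarRing Q] {n : ℕ} (u x y : Fin n → Q) : Q :=
  ∑ i, star (x i) * u i * y i

/-- The involution adjoint to `⟨u₁, …, uₙ⟩` (all `uᵢ` invertible): with `H = diag(u₁, …, uₙ)` it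
is `M ↦ H⁻¹ Mᴴ H`, where `ᴴ` is the conjugate transpose. -/
noncomputable def adjInvolution {Q : Type u} [Ring Q] [StarRing Q] {n : ℕ} (u : Fin n → Q)
    (M : Matrix (Fin n) (Fin n) Q) : Matrix (Fin n) (Fin n) Q :=
  Matrix.diagonal (fun i => Ring.inverse (u i)) * Mᴴ * Matrix.diagonal u

/-- The defining property of the adjoint involution of a diagonal skew-hermitian form. -/
theorem diagForm_adjInvolution {Q : Type u} [Ring Q] [StarRing Q] {n : ℕ} (u : Fin n → Q)
    (hu : ∀ i, IsUnit (u i)) (hs : ∀ i, star (u i) = -u i) (M : Matrix (Fin n) (Fin n) Q)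
    (x y : Fin n → Q) :
    diagForm u x (M *ᵥ y) = diagForm u (adjInvolution u M *ᵥ x) y := by
  have hv : ∀ i, star (Ring.inverse (u i)) * u i = -1 := by
    intro i
    have h1 : u i * Ring.inverse (u i) = 1 := Ring.mul_inverse_cancel _ (hu i)
    have h2 : star (Ring.inverse (u i)) * star (u i) = 1 := by rw [← star_mul, h1, star_one]
    rw [hs i, mul_neg] at h2
    exact neg_eq_iff_eq_neg.mp h2
  have hv' : ∀ i j, star (u j) * M j i * star (Ring.inverse (u i)) * u i = u j * M j i := by
    intro i j
    rw [mul_assoc, hv i, hs j]; simp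
  simp only [diagForm, adjInvolution, Matrix.mulVec, dotProduct, Matrix.mul_diagonal,
    Matrix.diagonal_mul, Matrix.conjTranspose_apply, star_sum, star_mul, star_star,
    Finset.mul_sum, Finset.sum_mul]
  rw [Finset.sum_comm]
  refine Finset.sum_congr rfl fun i _ => Finset.sum_congr rfl fun j _ => ?_
  rw [show star (x j) * (star (u j) * (M j i * star (Ring.inverse (u i)))) * u i * y i
    = star (x j) * (star (u j) * M j i * star (Ring.inverse (u i)) * u i) * y i by
      simp only [mul_assoc], hv' i j]
  simp only [mul_assoc]

/-! ## Similitudes and discriminant of an orthogonal involution on `M_n(Q)` -/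

/-- `g` is a similitude of `(M_n(Q), σ)` with multiplier `μ ∈ Kˣ`. -/
def IsSimilitude {K : Type u} [Field K] {a b : K} {n : ℕ}
    (σ : Matrix (Fin n) (Fin n) ℍ[K, a, b] → Matrix (Fin n) (Fin n) ℍ[K, a, b])
    (g : Matrix (Fin n) (Fin n) ℍ[K, a, b]) (μ : K) : Prop :=
  IsUnit g ∧ μ ≠ 0 ∧ σ g * g = algebraMap K _ μ

/-- `g` is an improper similitude: a similitude whose reduced norm is `-μ(g)ⁿ`
(the degree of `M_n(Q)` being `2n`). -/
def IsImproperSimilitude {K : Type u} [Field K] {a b : K} {n : ℕ}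
    (σ : Matrix (Fin n) (Fin n) ℍ[K, a, b] → Matrix (Fin n) (Fin n) ℍ[K, a, b])
    (g : Matrix (Fin n) (Fin n) ℍ[K, a, b]) : Prop :=
  ∃ μ : K, IsSimilitude σ g μ ∧ reducedNorm g = algebraMap K _ (-μ ^ n)

/-- `g²` is a central scalar. -/
def IsSquareCentral {K : Type u} [Field K] {a b : K} {n : ℕ}
    (g : Matrix (Fin n) (Fin n) ℍ[K, a, b]) : Prop :=
  ∃ c : K, g * g = algebraMap K _ c

/-- `d ∈ Kˣ` represents the discriminant of `σ` (an element of `Kˣ/Kˣ²`): for some invertible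
`σ`-skew-symmetric `x`, `d = (-1)ⁿ Nrd(x)`.  The discriminant quadratic algebra is `K(√d)`. -/
def RepresentsDisc {K : Type u} [Field K] {a b : K} {n : ℕ}
    (σ : Matrix (Fin n) (Fin n) ℍ[K, a, b] → Matrix (Fin n) (Fin n) ℍ[K, a, b]) (d : K) : Prop :=
  d ≠ 0 ∧ ∃ x, IsUnit x ∧ σ x = -x ∧ reducedNorm x = algebraMap K _ ((-1) ^ n * d)

/-! ## Iterated Laurent series -/

/-- `F((t₁))((t₂))⋯((tₙ))`. -/
def IterLaurent : ℕ → (F : Type u) → [Field F] → Type u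
  | 0, F, _ => F
  | n + 1, F, _ => IterLaurent n (LaurentSeries F)

noncomputable instance IterLaurent.instField :
    (n : ℕ) → (F : Type u) → [Field F] → Field (IterLaurent n F)
  | 0, _, i => i
  | n + 1, F, _ => IterLaurent.instField n (LaurentSeries F)

/-- The inclusion of constants `F → F((t₁))⋯((tₙ))`. -/
noncomputable def IterLaurent.C :
    (n : ℕ) → (F : Type u) → [Field F] → F →+* IterLaurent n F
  | 0, F, _ => RingHom.id F
  | n + 1, F, _ => (IterLaurent.C n (LaurentSeries F)).comp HahnSeries.C

noncomputable instance IterLaurent.instAlgebra (n : ℕ) (F : Type u) [Field F] :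
    Algebra F (IterLaurent n F) :=
  (IterLaurent.C n F).toAlgebra

/-- The indeterminates `t₁, …, tₙ` (indexed from `0`) of `F((t₁))⋯((tₙ))`. -/
noncomputable def IterLaurent.t :
    (n : ℕ) → (F : Type u) → [Field F] → Fin n → IterLaurent n F
  | 0, _, _ => Fin.elim0
  | n + 1, F, _ =>
      Fin.cases (IterLaurent.C n (LaurentSeries F) (HahnSeries.single 1 1))
        (IterLaurent.t n (LaurentSeries F))

/-! ## The generic involution -/

/-- The sequence `q₁, q₂, q₃, q₃, …, q₃` of length `n`. -/
def padSeq {Q : Type u} (q₁ q₂ q₃ : Q) (n : ℕ) (i : Fin n) : Q :=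
  if i.val = 0 then q₁ else if i.val = 1 then q₂ else q₃

/-- The involution on `M_n(Q̂)`, `Q̂ = Q ⊗ F((t₁))⋯((tₙ))`, adjoint to the skew-hermitian form
`⟨t₁q₁, …, tₙqₙ⟩`. -/
noncomputable def genericInvolution {F : Type u} [Field F] {α β : F} {n : ℕ}
    (q : Fin n → ℍ[F, α, β]) :
    Matrix (Fin n) (Fin n) (QuatExt (IterLaurent n F) α β) →
      Matrix (Fin n) (Fin n) (QuatExt (IterLaurent n F) α β) :=
  adjInvolution fun i => IterLaurent.t n F i • quatExtMap (IterLaurent n F) α β (q i)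

/-! ## Quaternion algebras -/

section Quaternions

variable {K : Type u} [Field K] {α β : K}

/-! Write `K` for the iterated Laurent series field. It carries a place with residue field `F` whose
value group separates the `tᵢ` modulo squares (`IterLaurent.valuation_t_mul_t_mul_sq_ne_one`). As
`Q` is division, the largest value of a coordinate is multiplicative on `Q ⊗ K`
(`ResiduePlace.quatNorm_mul`), so `Q ⊗ K` is a valued division algebra with residue algebra `Q`.

Let `g` be a similitude with multiplier `μ`. The `j`-th diagonal entry of `gᴴ H g = μ H`, with `H =
diag(tᵢqᵢ)`, is a sum of terms of value `v(tₖ) w(gₖⱼ)²`, whose classes modulo squares are distinct.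
Hence one term, of index `π j`, dominates, and `v(t_{π j})` has the class of `v(μ tⱼ)`. So `π` is an
involution; as `n` is odd it has a fixed point, which makes `v(μ)` a square and `π` the identity.
After scaling, `μ` is a unit, the diagonal entries of `g` are units and the other entries are small
for the weights `v(tᵢ)` (`ResiduePlace.exists_diagonally_dominant`).

Reduction gives `m ≠ 0` in `F` and nonzero `xⱼ` in `Q` with `x̄ⱼ qⱼ xⱼ = m qⱼ`. If `g` is improper,
then `∏ Nrd(xⱼ) = -mⁿ`; if `g²` is a scalar, all `xⱼ²` equal one scalar
(`ResiduePlace.exists_residue`). Each `xⱼ` either commutes with `qⱼ` and has norm `m`, or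
anticommutes with it and has norm `-m`. The product formula forces an anticommuting one. If all of
them anticommuted, `qⱼ` and `xⱼ` would present `Q` as `(aⱼ, m)` for every `j`, against (2). So both
kinds occur (`nonempty_algEquiv_or_mixed`). Norms `m` and `-m` make `-1` a norm, which gives (c). A
common scalar square is impossible for the two kinds (`false_of_mixed_of_mul_self_eq`), which gives
(a).

For (b), `x` skew-symmetric makes `H x` hermitian, and hermitian matrices have square reduced norm
(`exists_nrd_eq_sq_of_isHermitian`), so the class of the discriminant is determined by `Nrd(H)`. By
(1), `Q` contains a square root of `a₁a₂a₃`; rescaled in `Q ⊗ K`, it becomes a square root of any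
representative of the discriminant. That representative is not a square because `Q ⊗ K` is division.
-/

theorem re_eq_zero_of_anticommute (h2 : (2 : K) ≠ 0) {q x : ℍ[K, α, β]} (hq : q.re = 0)
    (hq0 : q ≠ 0) (h : q * x = -(x * q)) : x.re = 0 := by
  by_contra hx
  have hI := congrArg QuaternionAlgebra.imI h
  have hJ := congrArg QuaternionAlgebra.imJ h
  have hK := congrArg QuaternionAlgebra.imK h
  simp [hq] at hI hJ hK
  -- The imaginary part of `q * x + x * q` is `2 * x.re` times `q`, since `q` is pure.
  have h2x : 2 * x.re ≠ 0 := mul_ne_zero h2 hx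
  apply hq0
  ext
  · simpa using hq
  · exact (mul_eq_zero.mp (show 2 * x.re * q.imI = 0 by linear_combination hI)).resolve_left h2x
  · exact (mul_eq_zero.mp (show 2 * x.re * q.imJ = 0 by linear_combination hJ)).resolve_left h2x
  · exact (mul_eq_zero.mp (show 2 * x.re * q.imK = 0 by linear_combination hK)).resolve_left h2x

theorem mul_star_self_of_re_eq_zero {x : ℍ[K, α, β]} (hx : x.re = 0) : x * star x = -(x * x) := by
  have : star x = -x := by ext <;> simp [hx]
  rw [this, mul_neg]

theorem mul_self_eq_of_re_eq_zero {x : ℍ[K, α, β]} (hx : x.re = 0) :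
    x * x = algebraMap K _ (-(x * star x).re) := by
  have h := QuaternionAlgebra.mul_star_eq_coe x
  rw [QuaternionAlgebra.coe_algebraMap.symm] at h
  rw [map_neg, ← h, mul_star_self_of_re_eq_zero hx, neg_neg]

/-- Two anticommuting elements with nonzero scalar squares `d`, `e` identify a quaternion algebra
with `(d, e)`. -/
theorem nonempty_algEquiv_of_anticommute (h2 : (2 : K) ≠ 0) {d e : K} (hd : d ≠ 0) (he : e ≠ 0)
    {p b : ℍ[K, α, β]} (hp : p * p = algebraMap K _ d) (hb : b * b = algebraMap K _ e)
    (hpb : p * b = -(b * p)) : Nonempty (ℍ[K, α, β] ≃ₐ[K] ℍ[K, d, e]) := by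
  let B : QuaternionAlgebra.Basis ℍ[K, α, β] d 0 e :=
    { i := p
      j := b
      k := p * b
      i_mul_i := by rw [hp, zero_smul, add_zero, Algebra.algebraMap_eq_smul_one]
      j_mul_j := by rw [hb, Algebra.algebraMap_eq_smul_one]
      i_mul_j := rfl
      j_mul_i := by rw [hpb]; simp }
  let f := B.liftHom
  have hre : ∀ z : ℍ[K, d, e], f z = 0 → z.re = 0 := by
    intro z hz
    let I : ℍ[K, d, e] := ⟨0, 1, 0, 0⟩
    let J : ℍ[K, d, e] := ⟨0, 0, 1, 0⟩
    -- Conjugating by `I` and then by `J` averages out the three imaginary coordinates, so the real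
    -- part of a kernel element is seen by `f`.
    obtain ⟨r, hr⟩ : ∃ r, r = 4 * d * e * z.re := ⟨_, rfl⟩
    have key : e • (d • z + I * z * I) + J * (d • z + I * z * I) * J = algebraMap K _ r := by
      ext
      · simp [I, J]; linear_combination -hr
      all_goals simp [I, J]
      all_goals ring
    have h := congrArg f key
    simp only [map_add, map_mul, map_smul, hz, AlgHom.commutes] at h
    simp only [smul_zero, mul_zero, zero_mul, add_zero] at h
    have h4 : (4 : K) * d * e ≠ 0 := by
      have : (4 : K) = 2 * 2 := by norm_num
      rw [this]; exact mul_ne_zero (mul_ne_zero (mul_ne_zero h2 h2) hd) he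
    have h0 : 4 * d * e * z.re = 0 := by
      rw [← hr]
      simpa using (congrArg QuaternionAlgebra.re h).symm
    exact (mul_eq_zero.mp h0).resolve_left h4
  have hinj : Function.Injective f := by
    rw [injective_iff_map_eq_zero]
    intro z hz
    -- The kernel is an ideal; the real parts of `z` times `I`, `J`, `K` are the other coordinates
    -- of `z` up to nonzero factors.
    have hm : ∀ w : ℍ[K, d, e], (z * w).re = 0 := fun w => hre _ (by rw [map_mul, hz, zero_mul])
    have hI := hm ⟨0, 1, 0, 0⟩
    have hJ := hm ⟨0, 0, 1, 0⟩
    have hK := hm ⟨0, 0, 0, 1⟩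
    simp [hd, he] at hI hJ hK
    ext
    · exact hre z hz
    · simpa using hI
    · simpa using hJ
    · simpa using hK
  have hfin : Module.finrank K ℍ[K, d, e] = Module.finrank K ℍ[K, α, β] := by
    rw [QuaternionAlgebra.finrank_eq_four, QuaternionAlgebra.finrank_eq_four]
  have : FiniteDimensional K ℍ[K, d, e] := .of_finrank_pos (by
    rw [QuaternionAlgebra.finrank_eq_four]; norm_num)
  have : FiniteDimensional K ℍ[K, α, β] := .of_finrank_pos (by
    rw [QuaternionAlgebra.finrank_eq_four]; norm_num)
  have hsurj : Function.Surjective f :=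
    (LinearMap.injective_iff_surjective_of_finrank_eq_finrank (f := f.toLinearMap) hfin).mp hinj
  exact ⟨(AlgEquiv.ofBijective f ⟨hinj, hsurj⟩).symm⟩

/-- A quaternion algebra `(d, e)` over a ring in which `2`, `e` and a square root of `d` are
invertible is a matrix algebra. -/
theorem nonempty_algEquiv_matrix_of_sqrt {L : Type v} [CommRing L] {d e r r' e' h : L}
    (hr : r * r = d) (hr' : r * r' = 1) (he : e * e' = 1) (hh : 2 * h = 1) :
    Nonempty (ℍ[L, d, e] ≃ₐ[L] Matrix (Fin 2) (Fin 2) L) := by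
  let B : QuaternionAlgebra.Basis (Matrix (Fin 2) (Fin 2) L) d 0 e :=
    { i := !![r, 0; 0, -r]
      j := !![0, e; 1, 0]
      k := !![0, r * e; -r, 0]
      i_mul_i := by ext i j; fin_cases i <;> fin_cases j <;> simp [hr]
      j_mul_j := by ext i j; fin_cases i <;> fin_cases j <;> simp
      i_mul_j := by ext i j; fin_cases i <;> fin_cases j <;> simp
      j_mul_i := by ext i j; fin_cases i <;> fin_cases j <;> simp [mul_comm] }
  let f := B.liftHom
  have hf : ∀ x, f x = !![x.re + r * x.imI, e * x.imJ + r * e * x.imK;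
      x.imJ - r * x.imK, x.re - r * x.imI] := by
    intro x
    change B.lift x = _
    ext i j
    fin_cases i <;> fin_cases j <;>
      simp [QuaternionAlgebra.Basis.lift, B, Matrix.algebraMap_matrix_apply] <;> ring
  let g : Matrix (Fin 2) (Fin 2) L → ℍ[L, d, e] := fun m =>
    ⟨h * (m 0 0 + m 1 1), h * r' * (m 0 0 - m 1 1), h * (e' * m 0 1 + m 1 0),
      h * r' * (e' * m 0 1 - m 1 0)⟩
  have hfg : ∀ m, f (g m) = m := by
    intro m
    rw [hf]
    ext i j
    fin_cases i <;> fin_cases j <;> simp [g]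
    · linear_combination (h * (m 0 0 - m 1 1)) * hr' + m 0 0 * hh
    · linear_combination (h * e * (e' * m 0 1 - m 1 0)) * hr' + 2 * h * m 0 1 * he + m 0 1 * hh
    · linear_combination (- h * (e' * m 0 1 - m 1 0)) * hr' + m 1 0 * hh
    · linear_combination (- h * (m 0 0 - m 1 1)) * hr' + m 1 1 * hh
  have hgf : ∀ x, g (f x) = x := by
    intro x
    rw [hf]
    ext <;> simp [g]
    · linear_combination x.re * hh
    · linear_combination 2 * h * x.imI * hr' + x.imI * hh
    · linear_combination h * (x.imJ + r * x.imK) * he + x.imJ * hh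
    · linear_combination h * r' * (x.imJ + r * x.imK) * he + 2 * h * x.imK * hr' + x.imK * hh
  exact ⟨AlgEquiv.ofBijective f
    ⟨Function.LeftInverse.injective hgf, Function.RightInverse.surjective hfg⟩⟩

/-- `(d, e)` is split by `K(√d)`. -/
theorem isSplitBySqrt_self (h2 : (2 : K) ≠ 0) {d e : K} (hd : d ≠ 0) (he : e ≠ 0) :
    IsSplitBySqrt K ℍ[K, d, e] d := by
  obtain ⟨E, -⟩ := quatExt_baseChange (QuadraticAlgebra K d 0) d e
  have hone : (1 : QuadraticAlgebra K d 0) = ⟨1, 0⟩ := rfl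
  have htwo : (2 : QuadraticAlgebra K d 0) = ⟨2, 0⟩ := by
    rw [← one_add_one_eq_two, hone]; ext <;> simp [one_add_one_eq_two]
  obtain ⟨φ⟩ := nonempty_algEquiv_matrix_of_sqrt (L := QuadraticAlgebra K d 0)
    (d := algebraMap K _ d) (e := algebraMap K _ e) (r := ⟨0, 1⟩) (r' := ⟨0, 1 / d⟩)
    (e' := ⟨1 / e, 0⟩) (h := ⟨1 / 2, 0⟩) (by ext <;> simp) (by rw [hone]; ext <;> simp [hd])
    (by rw [hone]; ext <;> simp [he]) (by rw [hone, htwo]; ext <;> simp [h2])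
  exact ⟨E.trans φ⟩

theorem isSplitBySqrt_of_anticommute (h2 : (2 : K) ≠ 0) {d e : K} (hd : d ≠ 0) (he : e ≠ 0)
    {p b : ℍ[K, α, β]} (hp : p * p = algebraMap K _ d) (hb : b * b = algebraMap K _ e)
    (hpb : p * b = -(b * p)) : IsSplitBySqrt K ℍ[K, α, β] d := by
  obtain ⟨φ⟩ := nonempty_algEquiv_of_anticommute h2 hd he hp hb hpb
  obtain ⟨ψ⟩ := isSplitBySqrt_self h2 hd he
  exact ⟨(Algebra.TensorProduct.congr AlgEquiv.refl φ).trans ψ⟩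

/-- A division quaternion algebra split by `K(√d)` contains a square root of `d` which
anticommutes with some nonzero element. -/
theorem exists_sqrt_anticommute_of_isSplitBySqrt (hQ : IsDivisionAlg ℍ[K, α, β])
    {d : K} (h : IsSplitBySqrt K ℍ[K, α, β] d) :
    ∃ p b : ℍ[K, α, β], p * p = algebraMap K _ d ∧ b ≠ 0 ∧ p * b = -(b * p) := by
  obtain ⟨E, -⟩ := quatExt_baseChange (QuadraticAlgebra K d 0) α β
  obtain ⟨φ⟩ := h
  let L := QuadraticAlgebra K d 0
  -- A nonzero nilpotent of the matrix algebra becomes `z = a + √d b` with `z² = 0`, that is, `a² +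
  -- d b² = 0` and `ab + ba = 0`. Then `p = a b⁻¹` anticommutes with `b` and has square `d`.
  let N : Matrix (Fin 2) (Fin 2) L := !![0, 1; 0, 0]
  have hN : N * N = 0 := by
    refine Matrix.ext fun i j => ?_
    fin_cases i <;> fin_cases j <;> simp [N]
  have hN0 : N ≠ 0 := fun h => by
    have := congrFun (congrFun h 0) 1
    simp [N] at this
  let z : QuatExt L α β := E (φ.symm N)
  have hz : z * z = 0 := by simp only [z]; rw [← map_mul, ← map_mul, hN, map_zero, map_zero]
  have hz0 : z ≠ 0 := fun h => hN0 (by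
    have h1 : φ.symm N = 0 := (map_eq_zero_iff E E.injective).mp h
    exact (map_eq_zero_iff φ.symm φ.symm.injective).mp h1)
  let a : ℍ[K, α, β] := ⟨z.re.re, z.imI.re, z.imJ.re, z.imK.re⟩
  let b : ℍ[K, α, β] := ⟨z.re.im, z.imI.im, z.imJ.im, z.imK.im⟩
  have hr := congrArg QuaternionAlgebra.re hz
  have hi := congrArg QuaternionAlgebra.imI hz
  have hj := congrArg QuaternionAlgebra.imJ hz
  have hk := congrArg QuaternionAlgebra.imK hz
  have hrr := congrArg QuadraticAlgebra.re hr
  have hri := congrArg QuadraticAlgebra.im hr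
  have hir := congrArg QuadraticAlgebra.re hi
  have hii := congrArg QuadraticAlgebra.im hi
  have hjr := congrArg QuadraticAlgebra.re hj
  have hji := congrArg QuadraticAlgebra.im hj
  have hkr := congrArg QuadraticAlgebra.re hk
  have hki := congrArg QuadraticAlgebra.im hk
  simp [L] at hrr hri hir hii hjr hji hkr hki
  have h1 : a * a + d • (b * b) = 0 := by
    ext <;> simp [a, b]
    · linear_combination hrr
    · linear_combination hir
    · linear_combination hjr
    · linear_combination hkr
  have h2 : a * b + b * a = 0 := by
    ext <;> simp [a, b]
    · linear_combination hri
    · linear_combination hii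
    · linear_combination hji
    · linear_combination hki
  have hcancel : ∀ x y : ℍ[K, α, β], x ≠ 0 → y * x = 0 → y = 0 := fun x y hx hy =>
    (hQ.2 x hx).mul_left_eq_zero.mp hy
  have hb : b ≠ 0 := by
    intro hb
    have ha : a = 0 := by
      by_contra ha
      refine ha (hcancel a a ha ?_)
      rw [hb] at h1; simpa using h1
    apply hz0
    ext
    · simpa [a] using congrArg QuaternionAlgebra.re ha
    · simpa [b] using congrArg QuaternionAlgebra.re hb
    · simpa [a] using congrArg QuaternionAlgebra.imI ha
    · simpa [b] using congrArg QuaternionAlgebra.imI hb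
    · simpa [a] using congrArg QuaternionAlgebra.imJ ha
    · simpa [b] using congrArg QuaternionAlgebra.imJ hb
    · simpa [a] using congrArg QuaternionAlgebra.imK ha
    · simpa [b] using congrArg QuaternionAlgebra.imK hb
  obtain ⟨w, hw⟩ := hQ.2 b hb
  let p := a * ↑w⁻¹
  have hpa : p * b = a := by simp only [p]; rw [← hw]; simp
  have hpb : p * b = -(b * p) := by
    have : (p * b + b * p) * b = 0 := by
      rw [add_mul, mul_assoc b p b, hpa]; exact h2
    exact eq_neg_of_add_eq_zero_left (hcancel b _ hb this)
  refine ⟨p, b, ?_, hb, hpb⟩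
  have h3 : (d • 1 - p * p) * b * b = 0 := by
    have : a * a = -(p * p * b * b) := by
      rw [← hpa]
      calc p * b * (p * b) = p * (b * p) * b := by simp only [mul_assoc]
        _ = p * (-(p * b)) * b := by rw [hpb, neg_neg]
        _ = -(p * p * b * b) := by simp only [mul_neg, neg_mul, mul_assoc]
    rw [this] at h1
    rw [sub_mul, sub_mul, smul_mul_assoc, one_mul, smul_mul_assoc, ← h1]; abel
  have h4 := hcancel b _ hb (hcancel b _ hb h3)
  rw [Algebra.algebraMap_eq_smul_one]
  exact (sub_eq_zero.mp h4).symm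

/-- The imaginary part of `p²` is `2 * p.re` times that of `p`. If `p.re` were nonzero, `p` would be
a nonzero scalar, which cannot anticommute with `b ≠ 0`. -/
theorem re_eq_zero_of_mul_self (h2 : (2 : K) ≠ 0) (hQ : IsDivisionAlg ℍ[K, α, β]) {d : K}
    {p b : ℍ[K, α, β]} (hp : p * p = algebraMap K _ d) (hb : b ≠ 0)
    (hpb : p * b = -(b * p)) : p.re = 0 := by
  by_contra hre
  have hI := congrArg QuaternionAlgebra.imI hp
  have hJ := congrArg QuaternionAlgebra.imJ hp
  have hK := congrArg QuaternionAlgebra.imK hp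
  simp at hI hJ hK
  have h2x : 2 * p.re ≠ 0 := mul_ne_zero h2 hre
  have hpc : p = algebraMap K _ p.re := by
    ext
    · simp
    · simpa using (mul_eq_zero.mp
        (show 2 * p.re * p.imI = 0 by linear_combination hI)).resolve_left h2x
    · simpa using (mul_eq_zero.mp
        (show 2 * p.re * p.imJ = 0 by linear_combination hJ)).resolve_left h2x
    · simpa using (mul_eq_zero.mp
        (show 2 * p.re * p.imK = 0 by linear_combination hK)).resolve_left h2x
  rw [hpc, ← Algebra.commutes, eq_neg_iff_add_eq_zero, ← add_mul, ← map_add,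
    (hQ.2 b hb).mul_left_eq_zero, ← two_mul] at hpb
  generalize 2 * p.re = r at *
  exact h2x (by simpa using congrArg QuaternionAlgebra.re hpb)

/-- Two elements anticommuting, the second being nonzero and the first having nonzero square `d`,
can be completed to a standard presentation of a division quaternion algebra. -/
theorem mul_self_of_anticommute (h2 : (2 : K) ≠ 0) (hQ : IsDivisionAlg ℍ[K, α, β]) {d : K}
    (hd : d ≠ 0) {p b : ℍ[K, α, β]} (hp : p * p = algebraMap K _ d) (hb : b ≠ 0)
    (hpb : p * b = -(b * p)) : ∃ e : K, e ≠ 0 ∧ b * b = algebraMap K _ e := by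
  have hpre := re_eq_zero_of_mul_self h2 hQ hp hb hpb
  have hp0 : p ≠ 0 := by
    rintro rfl
    rw [zero_mul] at hp
    exact hd (by simpa using (congrArg QuaternionAlgebra.re hp).symm)
  have hbre := re_eq_zero_of_anticommute h2 hpre hp0 hpb
  refine ⟨_, ?_, mul_self_eq_of_re_eq_zero hbre⟩
  intro h
  have := mul_self_eq_of_re_eq_zero hbre
  rw [h, map_zero] at this
  exact hb ((hQ.2 b hb).mul_left_eq_zero.mp this)

/-- If `d = c²`, then `(p - c)(p + c) = 0`, and neither factor vanishes because `p` is pure and `c ≠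
0`. -/
theorem not_isSquare_of_sqrt_anticommute (h2 : (2 : K) ≠ 0) (hQ : IsDivisionAlg ℍ[K, α, β])
    {d : K} (hd : d ≠ 0) {p b : ℍ[K, α, β]} (hp : p * p = algebraMap K _ d) (hb : b ≠ 0)
    (hpb : p * b = -(b * p)) : ¬ IsSquare d := by
  rintro ⟨c, rfl⟩
  have hpre := re_eq_zero_of_mul_self h2 hQ hp hb hpb
  have hc : c ≠ 0 := left_ne_zero_of_mul hd
  have h : (p - algebraMap K _ c) * (p + algebraMap K _ c) = 0 := by
    rw [sub_mul, mul_add, mul_add, hp, map_mul, Algebra.commutes c p]; abel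
  by_cases h0 : p + algebraMap K _ c = 0
  · have := congrArg QuaternionAlgebra.re h0
    simp [hpre] at this
    exact hc this
  · have := congrArg QuaternionAlgebra.re ((hQ.2 _ h0).mul_left_eq_zero.mp h)
    simp [hpre] at this
    exact hc this

end Quaternions

/-! ## Reduced norms of matrices -/

section ReducedNorm

variable {K : Type u} [Field K] {a b : K} {ι κ : Type*} [Fintype ι] [DecidableEq ι] [Fintype κ]
  [DecidableEq κ]

theorem det_splitHom (x : ℍ[K, a, b]) :
    (splitHom a b x).det = algebraMap K _ (x * star x).re := by
  have h : splitHom a b x = (splitBasis a b).lift x := rfl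
  rw [h, Matrix.det_fin_two]
  ext <;> simp [QuaternionAlgebra.Basis.lift, splitBasis, Matrix.algebraMap_matrix_apply,
    QuadraticAlgebra.re_one, QuadraticAlgebra.im_one] <;> ring

/-- The reduced norm of a square matrix over `(a, b)_K` with arbitrary index type. -/
def nrd (M : Matrix ι ι ℍ[K, a, b]) : QuadraticAlgebra K a 0 :=
  (Matrix.comp ι ι (Fin 2) (Fin 2) _ (M.map (splitHom a b))).det

theorem reducedNorm_eq_nrd {n : ℕ} (M : Matrix (Fin n) (Fin n) ℍ[K, a, b]) :
    reducedNorm M = nrd M := rfl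

theorem nrd_mul (M N : Matrix ι ι ℍ[K, a, b]) : nrd (M * N) = nrd M * nrd N := by
  unfold nrd
  rw [Matrix.map_mul, ← Matrix.det_mul]
  exact congrArg Matrix.det (map_mul (Matrix.compRingEquiv ι (Fin 2) _) _ _)

theorem nrd_submatrix_equiv (e : κ ≃ ι) (M : Matrix ι ι ℍ[K, a, b]) :
    nrd (M.submatrix e e) = nrd M := by
  unfold nrd
  rw [← Matrix.det_submatrix_equiv_self (e.prodCongr (Equiv.refl (Fin 2)))]
  rfl

theorem nrd_fromBlocks_zero₂₁ (A : Matrix ι ι ℍ[K, a, b]) (B : Matrix ι κ ℍ[K, a, b])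
    (D : Matrix κ κ ℍ[K, a, b]) : nrd (Matrix.fromBlocks A B 0 D) = nrd A * nrd D := by
  unfold nrd
  rw [← Matrix.det_fromBlocks_zero₂₁ _ (Matrix.comp ι κ (Fin 2) (Fin 2) _ (B.map (splitHom a b))),
    ← Matrix.det_submatrix_equiv_self (Equiv.sumProdDistrib ι κ (Fin 2))]
  congr 1
  ext ⟨i | i, k⟩ ⟨j | j, l⟩ <;> simp

theorem nrd_fromBlocks_zero₁₂ (A : Matrix ι ι ℍ[K, a, b]) (C : Matrix κ ι ℍ[K, a, b])
    (D : Matrix κ κ ℍ[K, a, b]) : nrd (Matrix.fromBlocks A 0 C D) = nrd A * nrd D := by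
  unfold nrd
  rw [← Matrix.det_fromBlocks_zero₁₂ _ (Matrix.comp κ ι (Fin 2) (Fin 2) _ (C.map (splitHom a b))),
    ← Matrix.det_submatrix_equiv_self (Equiv.sumProdDistrib ι κ (Fin 2))]
  congr 1
  ext ⟨i | i, k⟩ ⟨j | j, l⟩ <;> simp

theorem nrd_one : nrd (1 : Matrix ι ι ℍ[K, a, b]) = 1 := by
  unfold nrd
  rw [Matrix.map_one _ (map_zero _) (map_one _), Matrix.comp_one, Matrix.det_one]

theorem det_comp_diagonal {R : Type*} [CommRing R] (d : ι → Matrix κ κ R) :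
    (Matrix.comp ι ι κ κ R (Matrix.diagonal d)).det = ∏ i, (d i).det := by
  rw [← Matrix.det_blockDiagonal, ← Matrix.det_submatrix_equiv_self (Equiv.prodComm κ ι)]
  congr 1
  ext ⟨k, i⟩ ⟨l, j⟩
  by_cases h : i = j
  · subst h; simp
  · simp [Matrix.blockDiagonal_apply, h]

theorem nrd_diagonal (d : ι → ℍ[K, a, b]) :
    nrd (Matrix.diagonal d) = algebraMap K _ (∏ i, (d i * star (d i)).re) := by
  unfold nrd
  rw [Matrix.diagonal_map (map_zero _), det_comp_diagonal, map_prod]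
  exact Finset.prod_congr rfl fun i _ => det_splitHom (d i)

theorem nrd_unit (A : Matrix Unit Unit ℍ[K, a, b]) :
    nrd A = algebraMap K _ (A () () * star (A () ())).re := by
  have : A = Matrix.diagonal fun _ => A () () := by ext <;> simp
  rw [this, nrd_diagonal]; simp

theorem eq_algebraMap_of_star_eq_self (h2 : (2 : K) ≠ 0) {x : ℍ[K, a, b]} (h : star x = x) :
    x = algebraMap K _ x.re := by
  have hI := congrArg QuaternionAlgebra.imI h
  have hJ := congrArg QuaternionAlgebra.imJ h
  have hK := congrArg QuaternionAlgebra.imK h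
  simp at hI hJ hK
  ext
  · simp
  · simpa using (mul_eq_zero.mp (show 2 * x.imI = 0 by linear_combination -hI)).resolve_left h2
  · simpa using (mul_eq_zero.mp (show 2 * x.imJ = 0 by linear_combination -hJ)).resolve_left h2
  · simpa using (mul_eq_zero.mp (show 2 * x.imK = 0 by linear_combination -hK)).resolve_left h2

/-- Splitting off a nonzero diagonal entry of a hermitian matrix. -/
theorem exists_nrd_eq_mul_nrd_of_isHermitian (h2 : (2 : K) ≠ 0)
    {S : Matrix (Unit ⊕ κ) (Unit ⊕ κ) ℍ[K, a, b]} (hS : S.IsHermitian)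
    (h0 : S (.inl ()) (.inl ()) ≠ 0) :
    ∃ (r : K) (T : Matrix κ κ ℍ[K, a, b]), T.IsHermitian ∧ nrd S = algebraMap K _ (r ^ 2) * nrd T := by
  obtain ⟨A, B, C, D, rfl⟩ : ∃ A B C D, S = Matrix.fromBlocks A B C D :=
    ⟨_, _, _, _, (Matrix.fromBlocks_toBlocks S).symm⟩
  rw [Matrix.isHermitian_fromBlocks_iff] at hS
  obtain ⟨hA, rfl, -, hD⟩ := hS
  have hAr := eq_algebraMap_of_star_eq_self h2 (hA.apply () ())
  obtain ⟨r, hr⟩ : ∃ r, r = (A () ()).re := ⟨_, rfl⟩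
  rw [← hr] at hAr
  have hA1 : A = r • (1 : Matrix Unit Unit ℍ[K, a, b]) := by
    refine Matrix.ext fun i j => ?_
    simp [hAr, Algebra.algebraMap_eq_smul_one]
  have hr0 : r ≠ 0 := by
    rintro rfl
    apply h0
    simp [hAr]
  have hstar : ∀ (s : K) (x : ℍ[K, a, b]), star (s • x) = s • star x := fun s x => by
    ext <;> simp
  -- The Schur complement of the scalar entry `r`, whose own reduced norm is `r²`. The column
  -- operation clearing `B` has reduced norm one.
  refine ⟨r, D - r⁻¹ • (Bᴴ * B), ?_, ?_⟩
  · refine hD.sub ?_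
    have h1 := Matrix.isHermitian_conjTranspose_mul_self B
    refine Matrix.ext fun i j => ?_
    rw [Matrix.conjTranspose_apply, Matrix.smul_apply, Matrix.smul_apply, hstar, h1.apply]
  · have h1 : Matrix.fromBlocks A B Bᴴ D * Matrix.fromBlocks 1 (-(r⁻¹ • B)) 0 1 =
        Matrix.fromBlocks A 0 Bᴴ (D - r⁻¹ • (Bᴴ * B)) := by
      rw [Matrix.fromBlocks_multiply, hA1]
      simp [hr0, sub_eq_add_neg, add_comm]
    have h2 := congrArg nrd h1
    rw [nrd_mul, nrd_fromBlocks_zero₂₁, nrd_one, nrd_one, mul_one, mul_one] at h2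
    rw [h2, nrd_fromBlocks_zero₁₂, nrd_unit, hAr]
    congr 2
    simp [sq]

/-- A hermitian matrix with a nonzero off-diagonal entry and vanishing diagonal is congruent, by a
transformation of reduced norm one, to one with a nonzero diagonal entry. -/
theorem exists_isHermitian_apply_ne_zero (h2 : (2 : K) ≠ 0)
    {S : Matrix (Unit ⊕ κ) (Unit ⊕ κ) ℍ[K, a, b]} (hS : S.IsHermitian) (hd : ∀ i, S i i = 0)
    {k : κ} (hk : IsUnit (S (.inl ()) (.inr k))) :
    ∃ T : Matrix (Unit ⊕ κ) (Unit ⊕ κ) ℍ[K, a, b], T.IsHermitian ∧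
      T (.inl ()) (.inl ()) ≠ 0 ∧ nrd T = nrd S := by
  obtain ⟨w, hw⟩ := hk
  -- With this `Y` the new corner entry is `w w⁻¹` plus its conjugate, that is, `2`, because the
  -- diagonal of `S` vanishes.
  let Y : Matrix κ Unit ℍ[K, a, b] := fun i _ => if i = k then (↑w⁻¹ : ℍ[K, a, b]) else 0
  let P : Matrix (Unit ⊕ κ) (Unit ⊕ κ) ℍ[K, a, b] := Matrix.fromBlocks 1 0 Y 1
  have hP : nrd P = 1 := by
    simp only [P]; rw [nrd_fromBlocks_zero₁₂, nrd_one, nrd_one, mul_one]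
  have hP' : nrd Pᴴ = 1 := by
    simp only [P]
    rw [Matrix.fromBlocks_conjTranspose, Matrix.conjTranspose_one, Matrix.conjTranspose_zero,
      Matrix.conjTranspose_one, nrd_fromBlocks_zero₂₁, nrd_one, nrd_one, mul_one]
  refine ⟨Pᴴ * S * P, Matrix.isHermitian_conjTranspose_mul_mul P hS, ?_, ?_⟩
  · have hk' : S (.inr k) (.inl ()) = star (w : ℍ[K, a, b]) := by rw [hw]; exact (hS.apply _ _).symm
    have hone : star (↑w⁻¹ : ℍ[K, a, b]) * star (w : ℍ[K, a, b]) = 1 := by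
      rw [← star_mul, Units.mul_inv, star_one]
    have hP1 : P (.inl ()) (.inl ()) = 1 := rfl
    have hP2 : ∀ i, P (.inr i) (.inl ()) = if i = k then (↑w⁻¹ : ℍ[K, a, b]) else 0 :=
      fun i => rfl
    have : (Pᴴ * S * P) (.inl ()) (.inl ()) = 2 := by
      simp only [Matrix.mul_apply, Matrix.conjTranspose_apply, Fintype.sum_sum_type,
        Finset.univ_unique, Finset.sum_singleton, PUnit.default_eq_unit, hP1, hP2, apply_ite star,
        star_one, star_zero, ite_mul, mul_ite, zero_mul, mul_zero, one_mul, mul_one,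
        Finset.sum_ite_eq', Finset.mem_univ, if_true, hd, hk', ← hw, hone, zero_add, add_zero,
        Units.mul_inv, one_add_one_eq_two]
    rw [this]
    intro h
    have h' : algebraMap K ℍ[K, a, b] 2 = 0 := by rw [← h]; exact map_ofNat _ 2
    generalize (2 : K) = r at h2 h'
    exact h2 (by simpa using congrArg QuaternionAlgebra.re h')
  · rw [nrd_mul, nrd_mul, hP, hP', one_mul, mul_one]

/-- The reduced norm of a hermitian matrix over a division quaternion algebra is a square. -/
theorem exists_nrd_eq_sq_of_isHermitian (h2 : (2 : K) ≠ 0) (hQ : IsDivisionAlg ℍ[K, a, b]) {n : ℕ}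
    {S : Matrix (Fin n) (Fin n) ℍ[K, a, b]} (hS : S.IsHermitian) :
    ∃ r : K, nrd S = algebraMap K _ (r ^ 2) := by
  induction n with
  | zero => exact ⟨1, by rw [Subsingleton.elim S 1, nrd_one, one_pow, map_one]⟩
  | succ n ih =>
    have key : ∀ T : Matrix (Unit ⊕ Fin n) (Unit ⊕ Fin n) ℍ[K, a, b], T.IsHermitian →
        T (.inl ()) (.inl ()) ≠ 0 → ∃ r : K, nrd T = algebraMap K _ (r ^ 2) := by
      intro T hT h0
      obtain ⟨r, T', hT', h⟩ := exists_nrd_eq_mul_nrd_of_isHermitian h2 hT h0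
      obtain ⟨s, hs⟩ := ih hT'
      exact ⟨r * s, by rw [h, hs, ← map_mul, mul_pow]⟩
    -- The reindexing `e i` brings `i` to the corner, where the splitting lemmas apply.
    let e : Fin (n + 1) → (Unit ⊕ Fin n ≃ Fin (n + 1)) := fun i =>
      ((finSuccEquiv' i).trans ((Equiv.optionEquivSumPUnit _).trans (Equiv.sumComm _ _))).symm
    have he : ∀ i, e i (.inl ()) = i := fun i => by simp [e]
    by_cases hd : ∀ i, S i i = 0
    · by_cases hz : S = 0
      · refine ⟨0, ?_⟩
        have := nrd_diagonal (ι := Fin (n + 1)) (a := a) (b := b) (K := K) fun _ => 0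
        rw [Matrix.diagonal_zero] at this
        rw [hz, this]
        simp
      · obtain ⟨i, j, hij⟩ : ∃ i j, S i j ≠ 0 := by
          by_contra! h
          exact hz (Matrix.ext h)
        obtain ⟨k, hk⟩ : ∃ k, e i (.inr k) = j := by
          obtain ⟨k | k, hk⟩ := (e i).surjective j
          · rw [he] at hk
            exact absurd (hk ▸ hd i) hij
          · exact ⟨k, hk⟩
        obtain ⟨T, hT, h0, h⟩ := exists_isHermitian_apply_ne_zero h2 (hS.submatrix (e i))
          (fun l => hd _) (k := k) (hQ.2 _ (by rw [Matrix.submatrix_apply, he, hk]; exact hij))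
        obtain ⟨r, hr⟩ := key T hT h0
        exact ⟨r, by rw [← hr, h, nrd_submatrix_equiv]⟩
    · obtain ⟨i, hi⟩ := not_forall.mp hd
      obtain ⟨r, hr⟩ := key _ (hS.submatrix (e i)) (by rw [Matrix.submatrix_apply, he]; exact hi)
      exact ⟨r, by rw [← hr, nrd_submatrix_equiv]⟩

end ReducedNorm

/-! ## Places with a section of the residue map -/

/-- A valuation ring of `K` with a map to `F` killing the maximal ideal, and of which `ι` is a
section. -/
structure ResiduePlace {F : Type u} {K : Type v} [Field F] [Field K] (ι : F →+* K) where
  /-- The valuation ring. -/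
  ring : ValuationSubring K
  /-- The residue map. -/
  res : ring →+* F
  res_eq_zero : ∀ x : ring, (x : K)⁻¹ ∉ ring → res x = 0
  map_mem : ∀ c, ι c ∈ ring
  res_map : ∀ c, res ⟨ι c, map_mem c⟩ = c

theorem ValuationSubring.valuation_eq_one_iff_mem {K : Type v} [Field K] (A : ValuationSubring K)
    (x : K) : A.valuation x = 1 ↔ x ≠ 0 ∧ x ∈ A ∧ x⁻¹ ∈ A := by
  constructor
  · intro h
    refine ⟨?_, (A.valuation_le_one_iff x).mp h.le, (A.valuation_le_one_iff _).mp ?_⟩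
    · rintro rfl; simp at h
    · rw [map_inv₀, h, inv_one]
  · rintro ⟨h0, h1, h2⟩
    refine le_antisymm ((A.valuation_le_one_iff x).mpr h1) ?_
    have h3 := (A.valuation_le_one_iff _).mpr h2
    rw [map_inv₀] at h3
    exact (inv_le_one₀ (zero_lt_iff.mpr ((map_ne_zero _).mpr h0))).mp h3

namespace ResiduePlace

variable {F : Type u} {F' : Type*} {K : Type v} [Field F] [Field F'] [Field K] {ι : F →+* F'}
  {ι' : F' →+* K}

/-- The trivial place of a field. -/
def trivial (F : Type u) [Field F] : ResiduePlace (RingHom.id F) where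
  ring := ⊤
  res := ValuationSubring.subtype ⊤
  res_eq_zero _ hx := absurd (ValuationSubring.mem_top _) hx
  map_mem _ := ValuationSubring.mem_top _
  res_map _ := rfl

theorem res_ne_zero (P : ResiduePlace ι) (x : P.ring) (h : P.ring.valuation (x : F') = 1) :
    P.res x ≠ 0 := by
  obtain ⟨h0, h1, h2⟩ := (P.ring.valuation_eq_one_iff_mem _).mp h
  intro hx
  have : x * ⟨_, h2⟩ = 1 := Subtype.ext (mul_inv_cancel₀ h0)
  have := congrArg P.res this
  rw [map_mul, hx, zero_mul, map_one] at this
  exact zero_ne_one this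

theorem res_eq_zero_iff (P : ResiduePlace ι) (x : P.ring) :
    P.res x = 0 ↔ P.ring.valuation (x : F') < 1 := by
  constructor
  · intro h
    exact lt_of_le_of_ne (P.ring.valuation_le_one x) fun h1 => P.res_ne_zero x h1 h
  · intro h
    by_cases h0 : (x : F') = 0
    · rw [show x = 0 from Subtype.ext h0, map_zero]
    · refine P.res_eq_zero x fun h2 => h.ne ?_
      exact (P.ring.valuation_eq_one_iff_mem _).mpr ⟨h0, x.2, h2⟩

theorem valuation_map (P : ResiduePlace ι) {c : F} (hc : c ≠ 0) : P.ring.valuation (ι c) = 1 :=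
  (P.ring.valuation_eq_one_iff_mem _).mpr
    ⟨(map_ne_zero ι).mpr hc, P.map_mem c, by rw [← map_inv₀]; exact P.map_mem _⟩

/-- The composite of two places. -/
def comp (P : ResiduePlace ι) (P' : ResiduePlace ι') : ResiduePlace (ι'.comp ι) where
  ring :=
    { carrier := {x | ∃ h : x ∈ P'.ring, P'.res ⟨x, h⟩ ∈ P.ring}
      mul_mem' := by
        rintro x y ⟨hx, hx'⟩ ⟨hy, hy'⟩
        exact ⟨mul_mem hx hy, (map_mul P'.res ⟨x, hx⟩ ⟨y, hy⟩) ▸ mul_mem hx' hy'⟩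
      one_mem' := ⟨one_mem _, (map_one P'.res).symm ▸ one_mem P.ring⟩
      add_mem' := by
        rintro x y ⟨hx, hx'⟩ ⟨hy, hy'⟩
        exact ⟨add_mem hx hy, (map_add P'.res ⟨x, hx⟩ ⟨y, hy⟩) ▸ add_mem hx' hy'⟩
      zero_mem' := ⟨zero_mem _, (map_zero P'.res).symm ▸ zero_mem P.ring⟩
      neg_mem' := by
        rintro x ⟨hx, hx'⟩
        exact ⟨neg_mem hx, (map_neg P'.res ⟨x, hx⟩) ▸ neg_mem hx'⟩
      mem_or_inv_mem' := by
        -- A nonunit of `P'.ring` has residue zero, which lies in `P.ring`. For a unit, the residues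
        -- of `x` and `x⁻¹` are inverse to each other, and `P.ring` contains one of them.
        intro x
        by_cases h1 : x ∈ P'.ring
        · by_cases h2 : x⁻¹ ∈ P'.ring
          · by_cases h0 : x = 0
            · subst h0
              exact .inl ⟨zero_mem _, (map_zero P'.res).symm ▸ zero_mem P.ring⟩
            · have h3 : P'.res ⟨x⁻¹, h2⟩ = (P'.res ⟨x, h1⟩)⁻¹ := by
                refine eq_inv_of_mul_eq_one_left ?_
                rw [← map_mul, ← map_one P'.res]
                exact congrArg _ (Subtype.ext (inv_mul_cancel₀ h0))
              rcases P.ring.mem_or_inv_mem (P'.res ⟨x, h1⟩) with h | h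
              · exact .inl ⟨h1, h⟩
              · exact .inr ⟨h2, h3 ▸ h⟩
          · exact .inl ⟨h1, by rw [P'.res_eq_zero ⟨x, h1⟩ h2]; exact zero_mem _⟩
        · have h2 := (P'.ring.mem_or_inv_mem x).resolve_left h1
          refine .inr ⟨h2, ?_⟩
          rw [P'.res_eq_zero ⟨x⁻¹, h2⟩ (by rwa [inv_inv])]
          exact zero_mem _ }
  res :=
    { toFun := fun x => P.res ⟨P'.res ⟨x.1, x.2.1⟩, x.2.2⟩
      map_one' := by
        rw [← map_one P.res]; exact congrArg _ (Subtype.ext (map_one P'.res))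
      map_mul' := fun x y => by
        rw [← map_mul P.res]; exact congrArg _ (Subtype.ext (map_mul P'.res ⟨x.1, x.2.1⟩ ⟨y.1, y.2.1⟩))
      map_zero' := by
        rw [← map_zero P.res]; exact congrArg _ (Subtype.ext (map_zero P'.res))
      map_add' := fun x y => by
        rw [← map_add P.res]; exact congrArg _ (Subtype.ext (map_add P'.res ⟨x.1, x.2.1⟩ ⟨y.1, y.2.1⟩)) }
  res_eq_zero := by
    rintro ⟨x, hx, hx'⟩ h
    change P.res ⟨P'.res ⟨x, hx⟩, hx'⟩ = 0
    by_cases h0 : P'.res ⟨x, hx⟩ = 0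
    · rw [← map_zero P.res]; exact congrArg _ (Subtype.ext h0)
    · have hxi : x⁻¹ ∈ P'.ring := by
        by_contra h'
        exact h0 (P'.res_eq_zero ⟨x, hx⟩ h')
      refine P.res_eq_zero _ fun h1 => h ⟨hxi, ?_⟩
      have hne : x ≠ 0 := by
        rintro rfl
        exact h0 (map_zero P'.res)
      have h3 : P'.res ⟨x⁻¹, hxi⟩ = (P'.res ⟨x, hx⟩)⁻¹ := by
        refine eq_inv_of_mul_eq_one_left ?_
        rw [← map_mul, ← map_one P'.res]
        exact congrArg _ (Subtype.ext (inv_mul_cancel₀ hne))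
      exact h3 ▸ h1
  map_mem c := ⟨P'.map_mem _, by
    have := P'.res_map (ι c)
    exact this.symm ▸ P.map_mem c⟩
  res_map c := by
    refine Eq.trans ?_ (P.res_map c)
    exact congrArg P.res (Subtype.ext (P'.res_map (ι c)))

/-- Units of a composite place are tested in two stages; this drives the inductions on the number of
indeterminates. -/
theorem valuation_eq_one_of_comp {P : ResiduePlace ι} {P' : ResiduePlace ι'} {x : K}
    (h : (P.comp P').ring.valuation x = 1) :
    ∃ hx : x ∈ P'.ring, P'.ring.valuation x = 1 ∧ P.ring.valuation (P'.res ⟨x, hx⟩) = 1 := by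
  obtain ⟨h0, ⟨h1, h1'⟩, ⟨h2, h2'⟩⟩ := (ValuationSubring.valuation_eq_one_iff_mem _ _).mp h
  have h3 := (ValuationSubring.valuation_eq_one_iff_mem _ _).mpr ⟨h0, h1, h2⟩
  have h4 : P'.res ⟨x⁻¹, h2⟩ = (P'.res ⟨x, h1⟩)⁻¹ := by
    refine eq_inv_of_mul_eq_one_left ?_
    rw [← map_mul, ← map_one P'.res]
    exact congrArg _ (Subtype.ext (inv_mul_cancel₀ h0))
  exact ⟨h1, h3, (ValuationSubring.valuation_eq_one_iff_mem _ _).mpr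
    ⟨P'.res_ne_zero ⟨x, h1⟩ h3, h1', h4 ▸ h2'⟩⟩

end ResiduePlace

/-! ## Laurent series -/

section Laurent

variable (F : Type u) [Field F]

theorem LaurentSeries.zero_le_order_of_mem_range {x : LaurentSeries F}
    (hx : x ∈ (HahnSeries.ofPowerSeries ℤ F).range) : 0 ≤ x.order := by
  obtain ⟨f, rfl⟩ := hx
  by_cases h0 : HahnSeries.ofPowerSeries ℤ F f = 0
  · rw [h0, HahnSeries.order_zero]
  · by_contra! h
    apply HahnSeries.coeff_order_eq_zero.not.mpr h0
    rw [PowerSeries.coeff_coe, if_pos h]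

theorem LaurentSeries.mem_range_of_zero_le_order {x : LaurentSeries F} (hx : 0 ≤ x.order) :
    x ∈ (HahnSeries.ofPowerSeries ℤ F).range := by
  obtain ⟨n, hn⟩ := Int.eq_ofNat_of_zero_le hx
  refine ⟨PowerSeries.X ^ n * x.powerSeriesPart, ?_⟩
  exact LaurentSeries.X_order_mul_powerSeriesPart hn.symm

theorem LaurentSeries.coeff_zero_ofPowerSeries (f : PowerSeries F) :
    (HahnSeries.ofPowerSeries ℤ F f).coeff 0 = PowerSeries.constantCoeff f := by
  simp [PowerSeries.coeff_coe]

/-- The place `t ↦ 0` of `F((t))`. -/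
noncomputable def laurentPlace : ResiduePlace (HahnSeries.C : F →+* LaurentSeries F) where
  ring := ValuationSubring.ofSubring (HahnSeries.ofPowerSeries ℤ F).range fun x => by
    by_cases h0 : x = 0
    · exact .inl (h0 ▸ zero_mem _)
    · have h : x.order + x⁻¹.order = 0 := by
        rw [← HahnSeries.order_mul h0 (inv_ne_zero h0), mul_inv_cancel₀ h0, HahnSeries.order_one]
      rcases le_total 0 x.order with h1 | h1
      · exact .inl (LaurentSeries.mem_range_of_zero_le_order F h1)
      · exact .inr (LaurentSeries.mem_range_of_zero_le_order F (by omega))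
  res :=
    { toFun := fun x => x.1.coeff 0
      map_one' := by simp
      map_mul' := by
        rintro ⟨_, f, rfl⟩ ⟨_, g, rfl⟩
        change (HahnSeries.ofPowerSeries ℤ F f * HahnSeries.ofPowerSeries ℤ F g).coeff 0 = _
        rw [← map_mul, LaurentSeries.coeff_zero_ofPowerSeries,
          LaurentSeries.coeff_zero_ofPowerSeries, LaurentSeries.coeff_zero_ofPowerSeries, map_mul]
      map_zero' := by simp
      map_add' := fun x y => by simp }
  res_eq_zero := by
    rintro ⟨_, f, rfl⟩ h
    by_contra h0
    have hc := LaurentSeries.coeff_zero_ofPowerSeries F f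
    have hu : IsUnit f := PowerSeries.isUnit_iff_constantCoeff.mpr
      (isUnit_iff_ne_zero.mpr fun h' => h0 (hc.trans h'))
    obtain ⟨w, rfl⟩ := hu
    apply h
    refine ⟨((w⁻¹ : (PowerSeries F)ˣ) : PowerSeries F), ?_⟩
    refine eq_inv_of_mul_eq_one_left ?_
    rw [← map_mul, Units.inv_mul, map_one]
  map_mem c := ⟨PowerSeries.C c, HahnSeries.ofPowerSeries_C c⟩
  res_map c := by
    change (HahnSeries.C c : LaurentSeries F).coeff 0 = c
    simp

/-- A unit would have order zero, while the order here is odd. -/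
theorem laurentPlace_valuation_ne_one (s : LaurentSeries F) :
    (laurentPlace F).ring.valuation (HahnSeries.single 1 1 * s ^ 2) ≠ 1 := by
  intro h
  obtain ⟨h0, h1, h2⟩ := (ValuationSubring.valuation_eq_one_iff_mem _ _).mp h
  have hs : s ≠ 0 := by rintro rfl; simp at h0
  have h3 := LaurentSeries.zero_le_order_of_mem_range F h1
  have h4 := LaurentSeries.zero_le_order_of_mem_range F h2
  have h5 : (HahnSeries.single 1 1 * s ^ 2).order + (HahnSeries.single 1 1 * s ^ 2)⁻¹.order = 0 := by
    rw [← HahnSeries.order_mul h0 (inv_ne_zero h0), mul_inv_cancel₀ h0, HahnSeries.order_one]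
  have h6 : (HahnSeries.single 1 (1 : F) * s ^ 2).order = 1 + (s.order + s.order) := by
    rw [sq, HahnSeries.order_mul (left_ne_zero_of_mul h0) (mul_ne_zero hs hs),
      HahnSeries.order_mul hs hs, HahnSeries.order_single one_ne_zero]
  omega

end Laurent

/-! ## Iterated Laurent series -/

/-- The place of `F((t₁))⋯((tₙ))` of rank `n` with residue field `F`. -/
noncomputable def IterLaurent.place :
    (n : ℕ) → (F : Type u) → [Field F] → ResiduePlace (IterLaurent.C n F)
  | 0, F, _ => ResiduePlace.trivial F
  | n + 1, F, _ => (laurentPlace F).comp (IterLaurent.place n (LaurentSeries F))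

theorem IterLaurent.t_ne_zero (n : ℕ) : ∀ (F : Type u) [Field F] (i : Fin n),
    IterLaurent.t n F i ≠ 0 := by
  induction n with
  | zero => exact fun F _ i => i.elim0
  | succ n ih =>
    intro F _ i
    refine Fin.cases ?_ (fun j => ?_) i
    · exact (map_ne_zero (IterLaurent.C n (LaurentSeries F))).mpr
        (HahnSeries.single_ne_zero one_ne_zero)
    · exact ih (LaurentSeries F) j

/-- The first indeterminate is a constant for the place with residue field `F((t₁))`. If the product
were a unit, `s` would be one too, and the residue would be `t₁` times a square, of odd order. For
the other indeterminates the place over `F((t₁))` already gives the contradiction, by induction. -/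
theorem IterLaurent.valuation_t_mul_sq_ne_one (n : ℕ) : ∀ (F : Type u) [Field F] (i : Fin n)
    (s : IterLaurent n F),
    (IterLaurent.place n F).ring.valuation (IterLaurent.t n F i * s ^ 2) ≠ 1 := by
  induction n with
  | zero => exact fun F _ i => i.elim0
  | succ n ih =>
    intro F _ i s h
    change IterLaurent n (LaurentSeries F) at s
    obtain ⟨hx, h1, h2⟩ := ResiduePlace.valuation_eq_one_of_comp (P := laurentPlace F)
      (P' := IterLaurent.place n (LaurentSeries F)) h
    refine Fin.cases (fun h hx h1 h2 => ?_) (fun j h hx h1 h2 => ?_) i h hx h1 h2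
    · let P := IterLaurent.place n (LaurentSeries F)
      let τ : LaurentSeries F := HahnSeries.single 1 1
      have hτ : τ ≠ 0 := HahnSeries.single_ne_zero one_ne_zero
      replace h1 : P.ring.valuation (IterLaurent.C n (LaurentSeries F) τ * s ^ 2) = 1 := h1
      rw [map_mul, P.valuation_map hτ, one_mul, map_pow] at h1
      have hs : s ∈ P.ring := (P.ring.valuation_le_one_iff s).mp
        (le_of_eq ((pow_eq_one_iff_of_nonneg zero_le two_ne_zero).mp h1))
      have : P.res ⟨_, hx⟩ = τ * P.res ⟨s, hs⟩ ^ 2 := by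
        conv_rhs => rw [← P.res_map τ, ← map_pow, ← map_mul]
        rfl
      replace h2 : (laurentPlace F).ring.valuation (P.res ⟨_, hx⟩) = 1 := h2
      rw [this] at h2
      exact laurentPlace_valuation_ne_one F _ h2
    · exact ih (LaurentSeries F) j s h1

/-- Distinct indeterminates have distinct classes in the value group modulo squares. When one of the
two is `t₁`, it is a unit for the place over `F((t₁))`, and the case of a single indeterminate
applies to the other. -/
theorem IterLaurent.valuation_t_mul_t_mul_sq_ne_one (n : ℕ) : ∀ (F : Type u) [Field F]
    (i j : Fin n) (_ : i ≠ j) (s : IterLaurent n F),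
    (IterLaurent.place n F).ring.valuation
      (IterLaurent.t n F i * IterLaurent.t n F j * s ^ 2) ≠ 1 := by
  induction n with
  | zero => exact fun F _ i => i.elim0
  | succ n ih =>
    intro F _
    let P := IterLaurent.place n (LaurentSeries F)
    have hτ : (HahnSeries.single 1 1 : LaurentSeries F) ≠ 0 := HahnSeries.single_ne_zero one_ne_zero
    have key : ∀ (j : Fin n) (s : IterLaurent n (LaurentSeries F)),
        P.ring.valuation (IterLaurent.C n (LaurentSeries F) (HahnSeries.single 1 1) *
          IterLaurent.t n (LaurentSeries F) j * s ^ 2) ≠ 1 := by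
      intro j s h
      rw [mul_assoc, map_mul, P.valuation_map hτ, one_mul] at h
      exact IterLaurent.valuation_t_mul_sq_ne_one n (LaurentSeries F) j s h
    intro i j hij s h
    change IterLaurent n (LaurentSeries F) at s
    obtain ⟨hx, h1, -⟩ := ResiduePlace.valuation_eq_one_of_comp (P := laurentPlace F)
      (P' := IterLaurent.place n (LaurentSeries F)) h
    clear h hx
    revert i j
    refine Fin.cases ?_ fun i => ?_ <;> refine Fin.cases ?_ fun j => ?_
    · exact fun h => absurd rfl h
    · exact fun _ h1 => key j s h1
    · intro _ h1
      refine key i s ?_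
      rw [mul_comm (IterLaurent.C n (LaurentSeries F) _)]
      exact h1
    · exact fun hij h1 => ih (LaurentSeries F) i j (fun h => hij (congrArg Fin.succ h)) s h1

/-! ## The valuation of an unramified quaternion algebra -/

/-- The homomorphism of quaternion algebras induced by a ring homomorphism. -/
def quatMap {R : Type*} {S : Type*} [CommRing R] [CommRing S] (f : R →+* S) {a b : R} {a' b' : S}
    (ha : f a = a') (hb : f b = b') : ℍ[R, a, b] →+* ℍ[S, a', b'] where
  toFun x := ⟨f x.re, f x.imI, f x.imJ, f x.imK⟩
  map_one' := by ext <;> simp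
  map_zero' := by ext <;> simp
  map_add' x y := by ext <;> simp
  map_mul' x y := by ext <;> simp [ha, hb]

namespace ResiduePlace

variable {F : Type u} {K : Type v} [Field F] [Field K] [Algebra F K]
  (P : ResiduePlace (algebraMap F K)) (α β : F)

/-- The quaternion algebra over the valuation ring. -/
abbrev Quat : Type v :=
  ℍ[P.ring, (⟨algebraMap F K α, P.map_mem α⟩ : P.ring), (⟨algebraMap F K β, P.map_mem β⟩ : P.ring)]

/-- The inclusion of the quaternions over the valuation ring. -/
def quatIncl : P.Quat α β →+* QuatExt K α β :=
  quatMap P.ring.subtype rfl rfl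

/-- The residue map on quaternions over the valuation ring. -/
def quatRes : P.Quat α β →+* ℍ[F, α, β] :=
  quatMap P.res (P.res_map α) (P.res_map β)

variable {α β}

theorem quatIncl_star (x : P.Quat α β) : P.quatIncl α β (star x) = star (P.quatIncl α β x) := by
  ext <;> simp [quatIncl, quatMap]

theorem quatRes_star (x : P.Quat α β) : P.quatRes α β (star x) = star (P.quatRes α β x) := by
  ext <;> simp [quatRes, quatMap]

theorem quatIncl_re (x : P.Quat α β) : (P.quatIncl α β x).re = x.re := rfl

theorem quatRes_re (x : P.Quat α β) : (P.quatRes α β x).re = P.res x.re := rfl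

theorem quatIncl_algebraMap (c : P.ring) :
    P.quatIncl α β (algebraMap P.ring _ c) = algebraMap K _ (c : K) := by
  ext <;> simp [quatIncl, quatMap]

theorem quatRes_algebraMap (c : P.ring) :
    P.quatRes α β (algebraMap P.ring _ c) = algebraMap F _ (P.res c) := by
  ext <;> simp [quatRes, quatMap]

/-- The constant quaternions over the valuation ring. -/
def quatConst (x : ℍ[F, α, β]) : P.Quat α β :=
  ⟨⟨_, P.map_mem x.re⟩, ⟨_, P.map_mem x.imI⟩, ⟨_, P.map_mem x.imJ⟩, ⟨_, P.map_mem x.imK⟩⟩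

theorem quatIncl_quatConst (x : ℍ[F, α, β]) :
    P.quatIncl α β (P.quatConst x) = quatExtMap K α β x := rfl

theorem quatRes_quatConst (x : ℍ[F, α, β]) : P.quatRes α β (P.quatConst x) = x := by
  ext <;> simp [quatRes, quatMap, quatConst, P.res_map]

/-- The maximum of the values of the coordinates. -/
noncomputable def quatNorm (x : QuatExt K α β) : P.ring.ValueGroup :=
  max (max (P.ring.valuation x.re) (P.ring.valuation x.imI))
    (max (P.ring.valuation x.imJ) (P.ring.valuation x.imK))

theorem quatNorm_le_iff {x : QuatExt K α β} {γ : P.ring.ValueGroup} :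
    P.quatNorm x ≤ γ ↔ (P.ring.valuation x.re ≤ γ ∧ P.ring.valuation x.imI ≤ γ) ∧
      P.ring.valuation x.imJ ≤ γ ∧ P.ring.valuation x.imK ≤ γ := by
  simp only [quatNorm, max_le_iff]

theorem quatNorm_lt_iff {x : QuatExt K α β} {γ : P.ring.ValueGroup} :
    P.quatNorm x < γ ↔ (P.ring.valuation x.re < γ ∧ P.ring.valuation x.imI < γ) ∧
      P.ring.valuation x.imJ < γ ∧ P.ring.valuation x.imK < γ := by
  simp only [quatNorm, max_lt_iff]

theorem exists_quatNorm_eq (x : QuatExt K α β) : ∃ c, P.quatNorm x = P.ring.valuation c := by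
  unfold quatNorm
  rcases max_choice (max (P.ring.valuation x.re) (P.ring.valuation x.imI))
    (max (P.ring.valuation x.imJ) (P.ring.valuation x.imK)) with h | h <;> rw [h]
  · rcases max_choice (P.ring.valuation x.re) (P.ring.valuation x.imI) with h | h <;>
      exact ⟨_, h⟩
  · rcases max_choice (P.ring.valuation x.imJ) (P.ring.valuation x.imK) with h | h <;>
      exact ⟨_, h⟩

theorem quatNorm_smul (c : K) (x : QuatExt K α β) :
    P.quatNorm (c • x) = P.ring.valuation c * P.quatNorm x := by
  simp [quatNorm, mul_max]

theorem exists_quatIncl_eq {x : QuatExt K α β} (hx : P.quatNorm x ≤ 1) :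
    ∃ X : P.Quat α β, P.quatIncl α β X = x := by
  simp only [quatNorm_le_iff, ValuationSubring.valuation_le_one_iff] at hx
  exact ⟨⟨⟨_, hx.1.1⟩, ⟨_, hx.1.2⟩, ⟨_, hx.2.1⟩, ⟨_, hx.2.2⟩⟩, rfl⟩

theorem quatNorm_quatIncl_le_one (X : P.Quat α β) : P.quatNorm (P.quatIncl α β X) ≤ 1 := by
  simp only [quatNorm_le_iff, ValuationSubring.valuation_le_one_iff]
  exact ⟨⟨X.re.2, X.imI.2⟩, X.imJ.2, X.imK.2⟩

theorem quatNorm_quatIncl_lt_one {X : P.Quat α β} :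
    P.quatNorm (P.quatIncl α β X) < 1 ↔ P.quatRes α β X = 0 := by
  rw [quatNorm_lt_iff, QuaternionAlgebra.ext_iff]
  simp only [quatIncl, quatRes, quatMap, RingHom.coe_mk, MonoidHom.coe_mk, OneHom.coe_mk,
    ValuationSubring.subtype_apply, ← P.res_eq_zero_iff, QuaternionAlgebra.re_zero,
    QuaternionAlgebra.imI_zero, QuaternionAlgebra.imJ_zero, QuaternionAlgebra.imK_zero, and_assoc]

theorem quatNorm_quatIncl_eq_one {X : P.Quat α β} :
    P.quatNorm (P.quatIncl α β X) = 1 ↔ P.quatRes α β X ≠ 0 := by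
  rw [Ne, ← P.quatNorm_quatIncl_lt_one, not_lt]
  exact ⟨fun h => h.ge, fun h => le_antisymm (P.quatNorm_quatIncl_le_one X) h⟩

/-- Division by a coordinate of largest value leaves a primitive integral quaternion, one whose
residue is nonzero. -/
theorem exists_smul_quatIncl_eq {x : QuatExt K α β} (hx : x ≠ 0) :
    ∃ (c : K) (X : P.Quat α β), P.quatRes α β X ≠ 0 ∧ x = c • P.quatIncl α β X := by
  obtain ⟨c, hc⟩ := P.exists_quatNorm_eq x
  have hc0 : c ≠ 0 := by
    rintro rfl
    rw [map_zero] at hc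
    have := (P.quatNorm_le_iff (x := x)).mp hc.le
    simp only [le_zero_iff, map_eq_zero] at this
    exact hx (QuaternionAlgebra.ext this.1.1 this.1.2 this.2.1 this.2.2)
  have hv : P.ring.valuation c ≠ 0 := (map_ne_zero _).mpr hc0
  have h1 : P.quatNorm (c⁻¹ • x) = 1 := by
    rw [quatNorm_smul, hc, map_inv₀, inv_mul_cancel₀ hv]
  obtain ⟨X, hX⟩ := P.exists_quatIncl_eq h1.le
  refine ⟨c, X, P.quatNorm_quatIncl_eq_one.mp (hX ▸ h1), ?_⟩
  rw [hX, smul_smul, mul_inv_cancel₀ hc0, one_smul]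

/-- For primitive factors the residue of the product is a product of nonzero elements of `Q`, hence
nonzero because `Q` is division. -/
theorem quatNorm_mul (hQ : IsDivisionAlg ℍ[F, α, β]) (x y : QuatExt K α β) :
    P.quatNorm (x * y) = P.quatNorm x * P.quatNorm y := by
  have h0 : P.quatNorm (0 : QuatExt K α β) = 0 := by simp [quatNorm]
  by_cases hx : x = 0
  · rw [hx, zero_mul, h0, zero_mul]
  by_cases hy : y = 0
  · rw [hy, mul_zero, h0, mul_zero]
  obtain ⟨c, X, hX, rfl⟩ := P.exists_smul_quatIncl_eq hx
  obtain ⟨d, Y, hY, rfl⟩ := P.exists_smul_quatIncl_eq hy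
  have hXY : P.quatRes α β (X * Y) ≠ 0 := by
    rw [map_mul]
    exact fun h => hX ((hQ.2 _ hY).mul_left_eq_zero.mp h)
  rw [smul_mul_smul_comm, ← map_mul, quatNorm_smul, quatNorm_smul, quatNorm_smul,
    P.quatNorm_quatIncl_eq_one.mpr hX, P.quatNorm_quatIncl_eq_one.mpr hY,
    P.quatNorm_quatIncl_eq_one.mpr hXY, map_mul, mul_one, mul_one, mul_one]

/-- The valuation of `Q ⊗ K` extending that of `K`, for a division quaternion algebra `Q` over the
residue field. -/
noncomputable def quatVal (hQ : IsDivisionAlg ℍ[F, α, β]) :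
    Valuation (QuatExt K α β) P.ring.ValueGroup where
  toFun := P.quatNorm
  map_zero' := by simp [quatNorm]
  map_one' := by simp [quatNorm]
  map_mul' := P.quatNorm_mul hQ
  map_add_le_max' x y := by
    rw [quatNorm_le_iff]
    have h : ∀ {a b c d : P.ring.ValueGroup}, a ≤ c → b ≤ d → max a b ≤ max c d := max_le_max
    exact ⟨⟨(P.ring.valuation.map_add _ _).trans
        (h ((le_max_left _ _).trans (le_max_left _ _)) ((le_max_left _ _).trans (le_max_left _ _))),
      (P.ring.valuation.map_add _ _).trans
        (h ((le_max_right _ _).trans (le_max_left _ _))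
          ((le_max_right _ _).trans (le_max_left _ _)))⟩,
      (P.ring.valuation.map_add _ _).trans
        (h ((le_max_left _ _).trans (le_max_right _ _))
          ((le_max_left _ _).trans (le_max_right _ _))),
      (P.ring.valuation.map_add _ _).trans
        (h ((le_max_right _ _).trans (le_max_right _ _))
          ((le_max_right _ _).trans (le_max_right _ _)))⟩

variable (hQ : IsDivisionAlg ℍ[F, α, β])

theorem quatVal_apply (x : QuatExt K α β) : P.quatVal hQ x = P.quatNorm x := rfl

theorem quatVal_smul (c : K) (x : QuatExt K α β) :
    P.quatVal hQ (c • x) = P.ring.valuation c * P.quatVal hQ x := P.quatNorm_smul c x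

theorem quatVal_star (x : QuatExt K α β) : P.quatVal hQ (star x) = P.quatVal hQ x := by
  simp [quatVal_apply, quatNorm, Valuation.map_neg]

theorem quatVal_quatExtMap {q : ℍ[F, α, β]} (hq : q ≠ 0) :
    P.quatVal hQ (quatExtMap K α β q) = 1 := by
  rw [← P.quatIncl_quatConst]
  exact P.quatNorm_quatIncl_eq_one.mpr (by rwa [quatRes_quatConst])

theorem quatVal_eq_zero {x : QuatExt K α β} : P.quatVal hQ x = 0 ↔ x = 0 := by
  refine ⟨fun h => ?_, fun h => by rw [h, map_zero]⟩
  by_contra hx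
  obtain ⟨c, X, hX, rfl⟩ := P.exists_smul_quatIncl_eq hx
  rw [quatVal_smul, quatVal_apply, P.quatNorm_quatIncl_eq_one.mpr hX, mul_one, map_eq_zero] at h
  exact hx (by rw [h, zero_smul])

include P hQ in
-- A multiplicative norm vanishing only at zero excludes zero divisors, so `x * star x` and `star x
-- * x` are nonzero scalars.
theorem isDivisionAlg_quatExt : IsDivisionAlg (QuatExt K α β) := by
  refine ⟨⟨0, 1, fun h => ?_⟩, fun x hx => ?_⟩
  · have := congrArg QuaternionAlgebra.re h
    simp at this
  · have h1 : x * star x = algebraMap K _ (x * star x).re := QuaternionAlgebra.mul_star_eq_coe x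
    have h2 : star x * x = algebraMap K _ (star x * x).re := QuaternionAlgebra.star_mul_eq_coe x
    have hn : ∀ y : QuatExt K α β, y ≠ 0 → ∀ z, z ≠ 0 → ∀ c : K, y * z = algebraMap K _ c →
        c ≠ 0 := by
      rintro y hy z hz c h rfl
      have h3 : P.quatVal hQ (y * z) = 0 := by rw [h, map_zero, map_zero]
      rw [map_mul, mul_eq_zero, quatVal_eq_zero, quatVal_eq_zero] at h3
      exact h3.elim hy hz
    have hs : star x ≠ 0 := fun h => hx (star_eq_zero.mp h)
    have h1' := (isUnit_iff_ne_zero.mpr (hn x hx _ hs _ h1)).map (algebraMap K (QuatExt K α β))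
    have h2' := (isUnit_iff_ne_zero.mpr (hn _ hs x hx _ h2)).map (algebraMap K (QuatExt K α β))
    rw [← h1] at h1'
    rw [← h2] at h2'
    obtain ⟨a, ha⟩ := h1'.exists_right_inv
    obtain ⟨b, hb⟩ := h2'.exists_left_inv
    rw [mul_assoc] at ha
    rw [← mul_assoc] at hb
    exact isUnit_iff_exists.mpr ⟨_, ha, by rwa [← left_inv_eq_right_inv hb ha]⟩

end ResiduePlace

/-! ## Dominant terms -/

/-- Terms of pairwise distinct values attain their maximum only once, and the value of the sum is
then that maximum. -/
theorem Valuation.exists_dominant_term {R Γ₀ ι : Type*} [Ring R] [LinearOrderedCommGroupWithZero Γ₀]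
    [Fintype ι] (V : Valuation R Γ₀) (f : ι → R)
    (hf : ∀ i j, i ≠ j → V (f i) ≠ 0 → V (f i) ≠ V (f j)) (h0 : V (∑ i, f i) ≠ 0) :
    ∃ i, V (f i) = V (∑ i, f i) ∧ ∀ j, j ≠ i → V (f j) < V (∑ i, f i) := by
  classical
  have hne : (Finset.univ : Finset ι).Nonempty := by
    rw [Finset.nonempty_iff_ne_empty]
    intro h
    rw [h, Finset.sum_empty, map_zero] at h0
    exact h0 rfl
  obtain ⟨i, -, hi⟩ := Finset.exists_max_image Finset.univ (fun i => V (f i)) hne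
  have hi0 : V (f i) ≠ 0 := by
    intro h
    apply h0
    rw [← le_zero_iff, ← h]
    exact V.map_sum_le fun j _ => hi j (Finset.mem_univ j)
  have hlt : ∀ j, j ≠ i → V (f j) < V (f i) := fun j hj =>
    lt_of_le_of_ne (hi j (Finset.mem_univ j)) (hf i j hj.symm hi0).symm
  have hsum : V (∑ i, f i) = V (f i) :=
    V.map_sum_eq_of_lt (Finset.mem_univ i) fun j hj => hlt j (by simpa using hj)
  exact ⟨i, hsum.symm, fun j hj => hsum ▸ hlt j hj⟩

theorem Function.Involutive.exists_fixed_point_of_odd {ι : Type*} [Fintype ι]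
    (hι : Odd (Fintype.card ι)) {π : ι → ι} (hπ : ∀ i, π (π i) = i) : ∃ i, π i = i := by
  have h2 : ¬ 2 ∣ Fintype.card ι := by
    rw [← even_iff_two_dvd, Nat.not_even_iff_odd]; exact hι
  have : Fact (Nat.Prime 2) := ⟨Nat.prime_two⟩
  obtain ⟨i, hi⟩ := Equiv.Perm.exists_fixed_point_of_prime (p := 2) (n := 1) h2
    (σ := Function.Involutive.toPerm π hπ) (by ext i; rw [pow_one, sq]; exact hπ i)
  exact ⟨i, hi⟩

/-- A determinant is congruent to that of its block diagonal part, when the off-diagonal blocks are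
small relatively to some weights. -/
theorem Valuation.map_det_sub_det_blocks_lt_one {L Γ₀ ι κ : Type*} [CommRing L]
    [LinearOrderedCommGroupWithZero Γ₀] [Fintype ι] [DecidableEq ι] [Fintype κ] [DecidableEq κ]
    (W : Valuation L Γ₀) (w : ι → Γ₀) (hw : ∀ i, w i ≠ 0) (M : Matrix (ι × κ) (ι × κ) L)
    (hle : ∀ x y, w x.1 * W (M x y) ^ 2 ≤ w y.1)
    (hlt : ∀ x y, x.1 ≠ y.1 → w x.1 * W (M x y) ^ 2 < w y.1) :
    W (M.det - (Matrix.of fun x y => if x.1 = y.1 then M x y else 0).det) < 1 := by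
  rw [Matrix.det_apply, Matrix.det_apply, ← Finset.sum_sub_distrib]
  refine W.map_sum_lt one_ne_zero fun σ _ => ?_
  rw [← smul_sub]
  have hsign : ∀ z : L, W (Equiv.Perm.sign σ • z) = W z := by
    intro z
    rcases Int.units_eq_one_or (Equiv.Perm.sign σ) with h | h <;> rw [h] <;> simp [Valuation.map_neg]
  rw [hsign]
  -- Permutations preserving the blocks contribute equally to both determinants; for the others the
  -- block diagonal product is zero.
  by_cases hσ : ∀ x, (σ x).1 = x.1
  · simp [hσ]
  · obtain ⟨x₀, hx₀⟩ := not_forall.mp hσ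
    rw [Finset.prod_eq_zero (Finset.mem_univ x₀) (f := fun x =>
      (Matrix.of fun x y : ι × κ => if x.1 = y.1 then M x y else 0) (σ x) x) (by simp [hx₀]),
      sub_zero, map_prod]
    refine lt_of_pow_lt_pow_left₀ 2 zero_le_one ?_
    rw [one_pow, ← Finset.prod_pow]
    -- The inserted weights cancel because `σ` is a bijection. Each factor is then at most one, and
    -- the one at `x₀` is strictly smaller.
    have hprod : ∏ x, W (M (σ x) x) ^ 2 =
        ∏ x, (w x.1)⁻¹ * (w (σ x).1 * W (M (σ x) x) ^ 2) := by
      rw [Finset.prod_mul_distrib, Finset.prod_mul_distrib,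
        Equiv.prod_comp σ (fun x : ι × κ => w x.1), ← mul_assoc, ← Finset.prod_mul_distrib]
      simp [hw]
    rw [hprod, ← Finset.mul_prod_erase _ _ (Finset.mem_univ x₀)]
    have hle1 : ∀ x : ι × κ, (w x.1)⁻¹ * (w (σ x).1 * W (M (σ x) x) ^ 2) ≤ 1 := fun x => by
      have := mul_le_mul_right (hle (σ x) x) (w x.1)⁻¹
      rwa [inv_mul_cancel₀ (hw _)] at this
    have hlt1 : (w x₀.1)⁻¹ * (w (σ x₀).1 * W (M (σ x₀) x₀) ^ 2) < 1 := by
      rw [inv_mul_lt_iff₀ (zero_lt_iff.mpr (hw _)), mul_one]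
      exact hlt _ _ hx₀
    exact lt_of_le_of_lt (mul_le_of_le_one_right' (Finset.prod_le_one' fun x _ => hle1 x)) hlt1

/-! ## Residues of similitudes -/

namespace ResiduePlace

variable {F : Type u} {K : Type v} [Field F] [Field K] [Algebra F K]
  (P : ResiduePlace (algebraMap F K)) {α β : F} (hQ : IsDivisionAlg ℍ[F, α, β])

theorem exists_valuation_eq_quatVal {x : QuatExt K α β} (hx : P.quatVal hQ x ≠ 0) :
    ∃ c, c ≠ 0 ∧ P.quatVal hQ x = P.ring.valuation c := by
  obtain ⟨c, hc⟩ := P.exists_quatNorm_eq x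
  refine ⟨c, ?_, hc⟩
  rintro rfl
  exact hx (by rw [quatVal_apply, hc, map_zero])

theorem quatVal_term {c : K} {r : ℍ[F, α, β]} (hr : r ≠ 0) (x : QuatExt K α β) :
    P.quatVal hQ (star x * (c • quatExtMap K α β r) * x) =
      P.ring.valuation c * P.quatVal hQ x ^ 2 := by
  rw [map_mul, map_mul, quatVal_smul, quatVal_quatExtMap P hQ hr, quatVal_star, mul_one]
  rw [mul_comm (P.quatVal hQ x), mul_assoc, ← sq]

variable {ι : Type*} [Fintype ι] [DecidableEq ι] {t : ι → K} {q : ι → ℍ[F, α, β]}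
  {g : Matrix ι ι (QuatExt K α β)} {μ : K}

include hQ in
/-- A similitude of `⟨t₁q₁, …, tₙqₙ⟩`, `n` odd, is diagonally dominant up to a scalar. -/
theorem exists_diagonally_dominant (hι : Odd (Fintype.card ι)) (ht : ∀ i, t i ≠ 0)
    (ht2 : ∀ i j, i ≠ j → ∀ s, P.ring.valuation (t i * t j * s ^ 2) ≠ 1)
    (hq : ∀ i, q i ≠ 0) (hμ : μ ≠ 0)
    (hg : ∀ j, ∑ k, star (g k j) * (t k • quatExtMap K α β (q k)) * g k j =
      (μ * t j) • quatExtMap K α β (q j)) :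
    ∃ s : K, s ≠ 0 ∧ P.ring.valuation μ = P.ring.valuation s ^ 2 ∧
      (∀ j, P.quatVal hQ (g j j) = P.ring.valuation s) ∧
      ∀ k j, k ≠ j → P.ring.valuation (t k) * P.quatVal hQ (g k j) ^ 2 <
        P.ring.valuation s ^ 2 * P.ring.valuation (t j) := by
  set v := P.ring.valuation with hv
  have hv0 : ∀ {c : K}, c ≠ 0 → v c ≠ 0 := fun h => (map_ne_zero _).mpr h
  -- The class of `v (t i)` modulo squares determines `i`.
  have hindep : ∀ i j c d, v (t i * c ^ 2) = v (t j * d ^ 2) → d ≠ 0 → i = j := by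
    intro i j c d h hd
    by_contra hij
    refine ht2 i j hij (c / (t j * d)) ?_
    have : t i * t j * (c / (t j * d)) ^ 2 = (t i * c ^ 2) / (t j * d ^ 2) := by
      have := ht j
      field_simp
    rw [this, map_div₀, h, div_self (hv0 (mul_ne_zero (ht j) (pow_ne_zero 2 hd)))]
  have hcol : ∀ j, ∃ i, v (t i) * P.quatVal hQ (g i j) ^ 2 = v (μ * t j) ∧
      ∀ k, k ≠ i → v (t k) * P.quatVal hQ (g k j) ^ 2 < v (μ * t j) := by
    intro j
    have hsum : P.quatVal hQ (∑ k, star (g k j) * (t k • quatExtMap K α β (q k)) * g k j) =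
        v (μ * t j) := by
      rw [hg, quatVal_smul, quatVal_quatExtMap P hQ (hq j), mul_one]
    have h := (P.quatVal hQ).exists_dominant_term
      (fun k => star (g k j) * (t k • quatExtMap K α β (q k)) * g k j) ?_ ?_
    · simpa only [hsum, quatVal_term P hQ (hq _)] using h
    · intro i k hik h0 h
      rw [h] at h0
      rw [quatVal_term P hQ (hq _), quatVal_term P hQ (hq _)] at h
      have h0' := h0
      rw [quatVal_term P hQ (hq _)] at h0'
      obtain ⟨d, hd, hd'⟩ := P.exists_valuation_eq_quatVal hQ
        (pow_ne_zero_iff two_ne_zero |>.mp (right_ne_zero_of_mul h0'))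
      obtain ⟨c, hc'⟩ := P.exists_quatNorm_eq (g i j)
      rw [quatVal_apply, hc', hd', ← map_pow, ← map_pow, ← map_mul, ← map_mul] at h
      exact hik (hindep i k c d h hd)
    · rw [hsum]
      exact hv0 (mul_ne_zero hμ (ht j))
  choose π hπ hπlt using hcol
  have hs : ∀ j, ∃ s, s ≠ 0 ∧ P.quatVal hQ (g (π j) j) = v s ∧ v (t (π j) * s ^ 2) = v (μ * t j) := by
    intro j
    have h0 : v (t (π j)) * P.quatVal hQ (g (π j) j) ^ 2 ≠ 0 := by
      rw [hπ]; exact hv0 (mul_ne_zero hμ (ht j))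
    obtain ⟨s, hs, hs'⟩ := P.exists_valuation_eq_quatVal hQ
      (pow_ne_zero_iff two_ne_zero |>.mp (right_ne_zero_of_mul h0))
    exact ⟨s, hs, hs', by rw [map_mul, map_pow, ← hπ, hs']⟩
  choose s hs0 hsv hs using hs
  -- Passing from `j` to `π j` multiplies the class of `v (t j)` by that of `v μ`; done twice, this
  -- multiplies it by a square.
  have hinv : ∀ j, π (π j) = j := by
    intro j
    refine hindep _ _ (s (π j) * s j) μ ?_ hμ
    have h1 := hs j
    have h2 := hs (π j)
    simp only [map_mul, map_pow] at h1 h2 ⊢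
    have h3 : v (t (π j)) ≠ 0 := hv0 (ht _)
    apply mul_left_cancel₀ h3
    calc
      _ = v (t (π (π j))) * v (s (π j)) ^ 2 * (v (t (π j)) * v (s j) ^ 2) := by
        rw [mul_pow]; ac_rfl
      _ = _ := by rw [h1, h2, sq]; ac_rfl
  obtain ⟨i, hi⟩ := Function.Involutive.exists_fixed_point_of_odd hι hinv
  -- The fixed point makes `v μ` a square, so `π` preserves every class and is the identity.
  have hμs : v μ = v (s i) ^ 2 := by
    have h1 := hs i
    rw [hi, map_mul, map_mul, map_pow, mul_comm] at h1
    exact (mul_right_cancel₀ (hv0 (ht i)) h1).symm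
  have hid : ∀ j, π j = j := by
    intro j
    refine hindep _ _ (s j) (s i) ?_ (hs0 i)
    rw [hs j, map_mul, map_mul, hμs, map_pow, mul_comm]
  refine ⟨s i, hs0 i, hμs, fun j => ?_, fun k j hkj => ?_⟩
  · have h1 := hs j
    rw [hid, map_mul, map_mul, hμs, map_pow, mul_comm] at h1
    have h2 := mul_right_cancel₀ (hv0 (ht j)) h1
    have h3 := hsv j
    rw [hid] at h3
    rw [h3]
    exact (pow_left_inj₀ zero_le zero_le two_ne_zero).mp h2
  · have := hπlt j k (by rw [hid]; exact hkj)
    rwa [map_mul, hμs] at this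

end ResiduePlace

/-! ### Reduction of a normalised similitude -/

namespace ResiduePlace

variable {F : Type u} {K : Type v} [Field F] [Field K] [Algebra F K]
  (P : ResiduePlace (algebraMap F K)) {α β : F} (hQ : IsDivisionAlg ℍ[F, α, β])

/-- The valuation of `K(√α)` obtained from its embedding in `(α, β)_K`. -/
noncomputable def quadVal :
    Valuation (QuadraticAlgebra K (algebraMap F K α) 0) P.ring.ValueGroup :=
  (P.quatVal hQ).comap
    { toFun := fun z => ⟨z.re, z.im, 0, 0⟩
      map_one' := by ext <;> simp [QuadraticAlgebra.re_one, QuadraticAlgebra.im_one]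
      map_zero' := by ext <;> simp
      map_add' := fun x y => by ext <;> simp
      map_mul' := fun x y => by ext <;> simp }

theorem quadVal_apply (z : QuadraticAlgebra K (algebraMap F K α) 0) :
    P.quadVal hQ z = max (P.ring.valuation z.re) (P.ring.valuation z.im) := by
  change P.quatNorm _ = _
  simp [quatNorm]

theorem quadVal_algebraMap (c : K) :
    P.quadVal hQ (algebraMap K _ c) = P.ring.valuation c := by
  simp [quadVal_apply]

theorem valuation_map_le_one (c : F) : P.ring.valuation (algebraMap F K c) ≤ 1 :=
  (P.ring.valuation_le_one_iff _).mpr (P.map_mem c)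

/-- The entries of the split matrix are made of coordinates of `x`, up to sign and a factor `β` of
value at most one. Bounds on quaternion entries thus pass to the determinant defining `nrd`. -/
theorem quadVal_splitHom_le (x : QuatExt K α β) (i j : Fin 2) :
    P.quadVal hQ (splitHom _ _ x i j) ≤ P.quatVal hQ x := by
  have h : splitHom _ _ x = (splitBasis (algebraMap F K α) (algebraMap F K β)).lift x := rfl
  have hx := (P.quatNorm_le_iff (x := x)).mp le_rfl
  have hβ : ∀ c : K, P.ring.valuation c ≤ P.quatNorm x →
      P.ring.valuation c * P.ring.valuation (algebraMap F K β) ≤ P.quatNorm x := fun c hc =>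
    (mul_le_of_le_one_right' (P.valuation_map_le_one β)).trans hc
  rw [h, quatVal_apply, quadVal_apply, max_le_iff]
  fin_cases i <;> fin_cases j <;>
    simp [QuaternionAlgebra.Basis.lift, splitBasis, Matrix.algebraMap_matrix_apply,
      QuadraticAlgebra.re_one, QuadraticAlgebra.im_one, Valuation.map_neg, hx, hβ]

variable {ι : Type*} [Fintype ι] [DecidableEq ι] {t : ι → K} {q : ι → ℍ[F, α, β]}
  {g : Matrix ι ι (QuatExt K α β)} {μ : K}

/-- The reduced norm of a diagonally dominant matrix. -/
theorem quadVal_nrd_sub_lt_one (ht : ∀ i, t i ≠ 0) (hd : ∀ j, P.quatVal hQ (g j j) = 1)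
    (hlt : ∀ k j, k ≠ j → P.ring.valuation (t k) * P.quatVal hQ (g k j) ^ 2 <
        P.ring.valuation (t j)) :
    P.quadVal hQ (nrd g - algebraMap K _ (∏ i, (g i i * star (g i i)).re)) < 1 := by
  have hle' : ∀ x y : ι × Fin 2, P.ring.valuation (t x.1) * P.quadVal hQ
      (splitHom _ _ (g x.1 y.1) x.2 y.2) ^ 2 ≤
        P.ring.valuation (t x.1) * P.quatVal hQ (g x.1 y.1) ^ 2 := fun x y =>
    mul_le_mul_right (pow_le_pow_left₀ zero_le (P.quadVal_splitHom_le hQ _ _ _) 2) _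
  have h := (P.quadVal hQ).map_det_sub_det_blocks_lt_one (fun i => P.ring.valuation (t i))
    (fun i => (map_ne_zero _).mpr (ht i))
    (Matrix.comp ι ι (Fin 2) (Fin 2) _ (g.map (splitHom _ _))) ?_ ?_
  · have hblock : nrd (Matrix.diagonal fun i => g i i) = (Matrix.of fun x y => if x.1 = y.1 then
        Matrix.comp ι ι (Fin 2) (Fin 2) _ (g.map (splitHom _ _)) x y else 0).det := by
      refine congrArg Matrix.det (Matrix.ext fun ⟨i, a⟩ ⟨j, b⟩ => ?_)
      by_cases hij : i = j
      · subst hij; simp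
      · simp [hij]
    rw [← nrd_diagonal, hblock]
    exact h
  · intro x y
    refine (hle' x y).trans ?_
    by_cases hxy : x.1 = y.1
    · rw [hxy, hd, one_pow, mul_one]
    · exact (hlt _ _ hxy).le
  · exact fun x y hxy => (hle' x y).trans_lt (hlt _ _ hxy)

include hQ in
/-- Reduction of a diagonally dominant similitude of `⟨t₁q₁, …, tₙqₙ⟩`. -/
theorem exists_residue_of_diagonally_dominant (ht : ∀ i, t i ≠ 0)
    (hq : ∀ i, q i ≠ 0) (hμ : P.ring.valuation μ = 1) (hd : ∀ j, P.quatVal hQ (g j j) = 1)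
    (hlt : ∀ k j, k ≠ j → P.ring.valuation (t k) * P.quatVal hQ (g k j) ^ 2 <
        P.ring.valuation (t j))
    (hg : ∀ j, ∑ k, star (g k j) * (t k • quatExtMap K α β (q k)) * g k j =
      (μ * t j) • quatExtMap K α β (q j)) :
    ∃ (m : F) (x : ι → ℍ[F, α, β]), m ≠ 0 ∧ (∀ j, x j ≠ 0) ∧
      (∀ j, star (x j) * q j * x j = m • q j) ∧
      (nrd g = algebraMap K _ (-μ ^ Fintype.card ι) →
        ∏ j, (x j * star (x j)).re = -m ^ Fintype.card ι) ∧
      ((∃ c, g * g = algebraMap K _ c) → ∃ c : F, ∀ j, x j * x j = algebraMap F _ c) := by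
  have hv0 : ∀ i, P.ring.valuation (t i) ≠ 0 := fun i => (map_ne_zero _).mpr (ht i)
  have hlift : ∀ j, ∃ X : P.Quat α β, P.quatIncl α β X = g j j := fun j =>
    P.exists_quatIncl_eq (hd j).le
  choose X hX using hlift
  obtain ⟨M, rfl⟩ : ∃ M : P.ring, (M : K) = μ :=
    ⟨⟨μ, (P.ring.valuation_le_one_iff μ).mp hμ.le⟩, rfl⟩
  refine ⟨P.res M, fun j => P.quatRes α β (X j), P.res_ne_zero M hμ, fun j => ?_, fun j => ?_,
    fun hn => ?_, ?_⟩
  · rw [← P.quatNorm_quatIncl_eq_one, hX]; exact hd j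
  · have h1 : t j • (star (g j j) * quatExtMap K α β (q j) * g j j -
        (M : K) • quatExtMap K α β (q j)) =
        -∑ k ∈ Finset.univ.erase j, star (g k j) * (t k • quatExtMap K α β (q k)) * g k j := by
      rw [smul_sub, smul_smul, mul_comm (t j), ← hg j,
        ← Finset.add_sum_erase _ _ (Finset.mem_univ j)]
      simp only [mul_smul_comm, smul_mul_assoc]
      abel
    have h2 : P.quatVal hQ (star (g j j) * quatExtMap K α β (q j) * g j j -
        (M : K) • quatExtMap K α β (q j)) < 1 := by
      have h3 : P.ring.valuation (t j) * P.quatVal hQ (star (g j j) * quatExtMap K α β (q j) *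
          g j j - (M : K) • quatExtMap K α β (q j)) < P.ring.valuation (t j) := by
        rw [← quatVal_smul, h1, Valuation.map_neg]
        refine (P.quatVal hQ).map_sum_lt (hv0 j) fun k hk => ?_
        rw [quatVal_term P hQ (hq k)]
        exact hlt k j (Finset.ne_of_mem_erase hk)
      exact (mul_lt_iff_lt_one_right (zero_lt_iff.mpr (hv0 j))).mp h3
    have h4 : star (g j j) * quatExtMap K α β (q j) * g j j - (M : K) • quatExtMap K α β (q j) =
        P.quatIncl α β (star (X j) * P.quatConst (q j) * X j -
          algebraMap P.ring _ M * P.quatConst (q j)) := by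
      rw [map_sub, map_mul, map_mul, map_mul, quatIncl_star, hX, quatIncl_quatConst,
        quatIncl_algebraMap, Algebra.smul_def]
    rw [h4] at h2
    have h5 := P.quatNorm_quatIncl_lt_one.mp h2
    rw [map_sub, map_mul, map_mul, map_mul, quatRes_star, quatRes_quatConst,
      quatRes_algebraMap, ← Algebra.smul_def] at h5
    exact sub_eq_zero.mp h5
  · have h1 := P.quadVal_nrd_sub_lt_one hQ ht hd hlt
    rw [hn, ← map_sub, quadVal_algebraMap] at h1
    have h2 : -(M : K) ^ Fintype.card ι - ∏ i, (g i i * star (g i i)).re =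
        ((-M ^ Fintype.card ι - ∏ i, (X i * star (X i)).re : P.ring) : K) := by
      push_cast
      congr 1
      refine Finset.prod_congr rfl fun i _ => ?_
      rw [← hX, ← quatIncl_star, ← map_mul, quatIncl_re]
    rw [h2, ← P.res_eq_zero_iff, map_sub, map_neg, map_pow, map_prod, sub_eq_zero] at h1
    rw [h1]
    refine Finset.prod_congr rfl fun i _ => ?_
    rw [← quatRes_star, ← map_mul, quatRes_re]
  · rintro ⟨c, hc⟩
    have hsmall : ∀ j, P.quatVal hQ (algebraMap K _ c - g j j * g j j) < 1 := by
      intro j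
      have h1 : algebraMap K _ c - g j j * g j j = ∑ k ∈ Finset.univ.erase j, g j k * g k j := by
        have := congrFun (congrFun hc j) j
        rw [Matrix.mul_apply, ← Finset.add_sum_erase _ _ (Finset.mem_univ j),
          Matrix.algebraMap_matrix_apply, if_pos rfl] at this
        rw [← this]; abel
      rw [h1]
      refine (P.quatVal hQ).map_sum_lt one_ne_zero fun k hk => ?_
      have hkj := Finset.ne_of_mem_erase hk
      refine lt_of_pow_lt_pow_left₀ 2 zero_le_one ?_
      rw [map_mul, one_pow, mul_pow]
      -- The weights `v (t j)` and `v (t k)` cancel in the product of the two bounds, so `g j k * g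
      -- k j` has value below one although neither entry need be integral.
      have h2 := mul_lt_mul'' (hlt j k hkj.symm) (hlt k j hkj) zero_le zero_le
      have h3 : P.ring.valuation (t k) * P.ring.valuation (t j) ≠ 0 := mul_ne_zero (hv0 k) (hv0 j)
      rw [mul_mul_mul_comm, mul_comm (P.ring.valuation (t j))] at h2
      exact (mul_lt_iff_lt_one_right (zero_lt_iff.mpr h3)).mp h2
    by_cases hne : Nonempty ι
    · obtain ⟨i⟩ := hne
      have hc1 : P.ring.valuation c ≤ 1 := by
        have h1 : P.quatVal hQ (algebraMap K _ c) ≤ 1 := by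
          rw [← sub_add_cancel (algebraMap K (QuatExt K α β) c) (g i i * g i i)]
          refine (P.quatVal hQ).map_add_le (hsmall i).le ?_
          rw [map_mul, hd, one_mul]
        rw [Algebra.algebraMap_eq_smul_one c, quatVal_smul, map_one, mul_one] at h1
        exact h1
      obtain ⟨C, rfl⟩ : ∃ C : P.ring, (C : K) = c :=
        ⟨⟨c, (P.ring.valuation_le_one_iff c).mp hc1⟩, rfl⟩
      refine ⟨P.res C, fun j => ?_⟩
      have h1 := hsmall j
      rw [← hX, ← map_mul, ← quatIncl_algebraMap, ← map_sub] at h1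
      have h2 := P.quatNorm_quatIncl_lt_one.mp h1
      rw [map_sub, map_mul, quatRes_algebraMap, sub_eq_zero] at h2
      exact h2.symm
    · exact ⟨0, fun j => absurd ⟨j⟩ hne⟩

end ResiduePlace

/-! ### Reduction of an arbitrary similitude -/

namespace ResiduePlace

variable {F : Type u} {K : Type v} [Field F] [Field K] [Algebra F K]
  (P : ResiduePlace (algebraMap F K)) {α β : F} (hQ : IsDivisionAlg ℍ[F, α, β])
  {ι : Type*} [Fintype ι] [DecidableEq ι] {t : ι → K} {q : ι → ℍ[F, α, β]}
  {g : Matrix ι ι (QuatExt K α β)} {μ : K}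

include P hQ in
/-- Reduction of a similitude of `⟨t₁q₁, …, tₙqₙ⟩` with `n` odd. -/
theorem exists_residue (hι : Odd (Fintype.card ι)) (ht : ∀ i, t i ≠ 0)
    (ht2 : ∀ i j, i ≠ j → ∀ s, P.ring.valuation (t i * t j * s ^ 2) ≠ 1)
    (hq : ∀ i, q i ≠ 0) (hμ : μ ≠ 0)
    (hg : ∀ j, ∑ k, star (g k j) * (t k • quatExtMap K α β (q k)) * g k j =
      (μ * t j) • quatExtMap K α β (q j)) :
    ∃ (m : F) (x : ι → ℍ[F, α, β]), m ≠ 0 ∧ (∀ j, x j ≠ 0) ∧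
      (∀ j, star (x j) * q j * x j = m • q j) ∧
      (nrd g = algebraMap K _ (-μ ^ Fintype.card ι) →
        ∏ j, (x j * star (x j)).re = -m ^ Fintype.card ι) ∧
      ((∃ c, g * g = algebraMap K _ c) → ∃ c : F, ∀ j, x j * x j = algebraMap F _ c) := by
  obtain ⟨s, hs, hμs, hd, hlt⟩ := P.exists_diagonally_dominant hQ hι ht ht2 hq hμ hg
  have hvs : P.ring.valuation s ≠ 0 := (map_ne_zero _).mpr hs
  have hstar : ∀ (c : K) (y : QuatExt K α β), star (c • y) = c • star y := fun c y => by
    ext <;> simp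
  -- Scaling by `s⁻¹` multiplies `μ` by `s⁻²` and the reduced norm by the matching power, so
  -- impropriety and square-centrality survive.
  have hsmul : s⁻¹ • g = Matrix.diagonal (fun _ => algebraMap K (QuatExt K α β) s⁻¹) * g := by
    refine Matrix.ext fun i j => ?_
    rw [Matrix.diagonal_mul, Matrix.smul_apply, Algebra.smul_def]
  have hμ' : P.ring.valuation (s⁻¹ ^ 2 * μ) = 1 := by
    rw [map_mul, hμs, map_pow, map_inv₀, ← mul_pow, inv_mul_cancel₀ hvs, one_pow]
  have hd' : ∀ j, P.quatVal hQ ((s⁻¹ • g) j j) = 1 := by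
    intro j
    rw [Matrix.smul_apply, quatVal_smul, hd, map_inv₀, inv_mul_cancel₀ hvs]
  have hlt' : ∀ k j, k ≠ j → P.ring.valuation (t k) * P.quatVal hQ ((s⁻¹ • g) k j) ^ 2 <
      P.ring.valuation (t j) := by
    intro k j hkj
    rw [Matrix.smul_apply, quatVal_smul, map_inv₀, mul_pow, mul_left_comm,
      inv_pow, inv_mul_lt_iff₀ (zero_lt_iff.mpr (pow_ne_zero 2 hvs))]
    exact hlt k j hkj
  have hg' : ∀ j, ∑ k, star ((s⁻¹ • g) k j) * (t k • quatExtMap K α β (q k)) * (s⁻¹ • g) k j =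
      (s⁻¹ ^ 2 * μ * t j) • quatExtMap K α β (q j) := by
    intro j
    rw [mul_assoc, mul_smul, ← hg j, Finset.smul_sum]
    refine Finset.sum_congr rfl fun k _ => ?_
    rw [Matrix.smul_apply, hstar, smul_mul_assoc, smul_mul_assoc, mul_smul_comm, smul_smul, sq]
  obtain ⟨m, x, hm, hx, h1, h2, h3⟩ :=
    P.exists_residue_of_diagonally_dominant hQ ht hq hμ' hd' hlt' hg'
  refine ⟨m, x, hm, hx, h1, fun h => h2 ?_, fun ⟨c, hc⟩ => h3 ⟨s⁻¹ * s⁻¹ * c, ?_⟩⟩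
  · have hN : (algebraMap K (QuatExt K α β) s⁻¹ * star (algebraMap K (QuatExt K α β) s⁻¹)).re =
        s⁻¹ ^ 2 := by
      simp [sq]
    rw [hsmul, nrd_mul, h, nrd_diagonal, ← map_mul, hN, Finset.prod_const, Finset.card_univ]
    congr 1
    ring
  · rw [smul_mul_smul_comm, hc, map_mul, Algebra.smul_def]

end ResiduePlace

/-! ## Similitudes of pure quaternions -/

section PureSimilitudes

variable {F : Type u} [Field F] {α β : F}

/-- A similitude of a one-dimensional skew-hermitian form `⟨q⟩` commutes or anticommutes with
`q`. -/
theorem commute_or_anticommute_of_star_mul_mul {q x : ℍ[F, α, β]} {a m : F} (hq : q * q = algebraMap F _ a) (ha : a ≠ 0) (hm : m ≠ 0)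
    (hx : x ≠ 0) (h : star x * q * x = m • q) :
    (q * x = x * q ∧ x * star x = algebraMap F _ m) ∨
      (q * x = -(x * q) ∧ x * star x = algebraMap F _ (-m)) := by
  obtain ⟨N, hN⟩ : ∃ N, x * star x = algebraMap F _ N := ⟨_, QuaternionAlgebra.mul_star_eq_coe x⟩
  -- Left multiplication by `x` replaces `x * star x` by its norm `N`. Using the relation twice
  -- gives `N² a = m² a`, so `N = ±m`.
  have h1 : N • (q * x) = m • (x * q) := by
    have := congrArg (x * ·) h
    simp only [mul_smul_comm] at this
    rw [← this, ← mul_assoc, ← mul_assoc, hN, Algebra.smul_def, mul_assoc]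
  have h2 : (N ^ 2 * a - m ^ 2 * a) • x = 0 := by
    have e1 : (N ^ 2 * a) • x = N • (q * (N • (q * x))) := by
      rw [mul_smul_comm, ← mul_assoc, hq, ← Algebra.smul_def, smul_smul, smul_smul, sq, mul_assoc]
    have e2 : (m ^ 2 * a) • x = m • (m • (x * q)) * q := by
      rw [smul_mul_assoc, smul_mul_assoc, mul_assoc, hq, ← Algebra.commutes, ← Algebra.smul_def,
        smul_smul, smul_smul, sq, mul_assoc]
    have e3 : N • (q * (N • (q * x))) = m • (m • (x * q)) * q := by
      rw [h1, mul_smul_comm, smul_comm N m, ← mul_assoc, ← smul_mul_assoc N, h1, smul_mul_assoc m,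
        smul_mul_assoc]
      simp only [smul_mul_assoc]
    rw [sub_smul, e1, e2, e3, sub_self]
  have h3 : (N - m) * (N + m) = 0 := by
    have := (smul_eq_zero.mp h2).resolve_right hx
    refine (mul_eq_zero.mp (show (N - m) * (N + m) * a = 0 by linear_combination this)).resolve_right
      ha
  rcases mul_eq_zero.mp h3 with h4 | h4
  · obtain rfl := sub_eq_zero.mp h4
    exact .inl ⟨smul_right_injective _ hm h1, hN⟩
  · obtain rfl := eq_neg_of_add_eq_zero_left h4
    refine .inr ⟨?_, hN⟩
    rw [neg_smul, neg_eq_iff_eq_neg, ← smul_neg] at h1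
    exact smul_right_injective _ hm h1

/-- Anticommuting with a nonzero pure quaternion makes `x` pure, and a pure quaternion has square
minus its norm. -/
theorem mul_self_eq_of_anticommute_of_norm (h2 : (2 : F) ≠ 0) {q x : ℍ[F, α, β]} {m : F}
    (hq : q.re = 0) (hq0 : q ≠ 0) (h : q * x = -(x * q)) (hN : x * star x = algebraMap F _ (-m)) :
    x * x = algebraMap F _ m := by
  have hx := re_eq_zero_of_anticommute h2 hq hq0 h
  rw [mul_star_self_of_re_eq_zero hx, map_neg] at hN
  exact neg_injective hN

variable {ι : Type*} [Fintype ι] {q x : ι → ℍ[F, α, β]} {a : ι → F} {m : F}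

/-- Similitudes `xᵢ` of `⟨qᵢ⟩` with the same multiplier `m`, of which an improper number
anticommutes with `qᵢ`: either all `(aᵢ, m)` are isomorphic to the given quaternion algebra, or one
`xᵢ` anticommutes and one commutes. -/
theorem nonempty_algEquiv_or_mixed (h2 : (2 : F) ≠ 0)
    (hre : ∀ i, (q i).re = 0) (hq : ∀ i, q i * q i = algebraMap F _ (a i)) (ha : ∀ i, a i ≠ 0)
    (hm : m ≠ 0) (hx : ∀ i, x i ≠ 0) (h : ∀ i, star (x i) * q i * x i = m • q i)
    (hprod : ∏ i, (x i * star (x i)).re = -m ^ Fintype.card ι) :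
    (∀ i, Nonempty (ℍ[F, α, β] ≃ₐ[F] ℍ[F, a i, m])) ∨
      ∃ i j, (q i * x i = -(x i * q i) ∧ x i * star (x i) = algebraMap F _ (-m)) ∧
        x j * star (x j) = algebraMap F _ m := by
  have hq0 : ∀ i, q i ≠ 0 := by
    intro i hi
    have := hq i
    rw [hi, zero_mul] at this
    exact ha i ((map_eq_zero_iff _ QuaternionAlgebra.algebraMap_injective).mp this.symm)
  have hdich := fun i => commute_or_anticommute_of_star_mul_mul (hq i) (ha i) hm (hx i) (h i)
  by_cases hall : ∀ i, q i * x i = -(x i * q i) ∧ x i * star (x i) = algebraMap F _ (-m)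
  · refine .inl fun i => ?_
    exact nonempty_algEquiv_of_anticommute h2 (ha i) hm (hq i)
      (mul_self_eq_of_anticommute_of_norm h2 (hre i) (hq0 i) (hall i).1 (hall i).2) (hall i).1
  · obtain ⟨j, hj⟩ := not_forall.mp hall
    have hj' := ((hdich j).resolve_right hj).2
    -- If every norm were `m`, the product would be both `mⁿ` and `-mⁿ`, impossible in
    -- characteristic different from two.
    by_cases hnone : ∀ i, x i * star (x i) = algebraMap F _ m
    · exfalso
      have : ∏ i, (x i * star (x i)).re = m ^ Fintype.card ι := by
        rw [← Finset.card_univ, ← Finset.prod_const]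
        refine Finset.prod_congr rfl fun i _ => ?_
        rw [hnone]; simp
      rw [this, eq_neg_iff_add_eq_zero, ← two_mul] at hprod
      exact mul_ne_zero h2 (pow_ne_zero _ hm) hprod
    · obtain ⟨i, hi⟩ := not_forall.mp hnone
      exact .inr ⟨i, j, (hdich i).resolve_left fun h => hi h.2, hj'⟩

/-- The element `m⁻¹ y z` has norm `m⁻² · (-m) · m = -1`. -/
theorem exists_norm_eq_neg_one {y z : ℍ[F, α, β]} (hm : m ≠ 0)
    (hy : y * star y = algebraMap F _ (-m)) (hz : z * star z = algebraMap F _ m) :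
    ∃ w : ℍ[F, α, β], w * star w = -1 := by
  refine ⟨m⁻¹ • (y * z), ?_⟩
  have hstar : ∀ (c : F) (y : ℍ[F, α, β]), star (c • y) = c • star y := fun c y => by
    ext <;> simp
  rw [hstar, star_mul, smul_mul_smul_comm, mul_assoc, ← mul_assoc z, hz, ← mul_assoc,
    ← Algebra.commutes, mul_assoc, hy, ← map_mul, Algebra.smul_def, ← map_mul, ← map_one
    (algebraMap F ℍ[F, α, β]), ← map_neg]
  congr 1
  field_simp

/-- In the mixed case the two similitudes do not have the same scalar square. -/
theorem false_of_mixed_of_mul_self_eq (h2 : (2 : F) ≠ 0) (hQ : IsDivisionAlg ℍ[F, α, β])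
    {p y z : ℍ[F, α, β]} {c : F} (hp : p.re = 0) (hp0 : p ≠ 0)
    (hpy : p * y = -(y * p)) (hy : y * star y = algebraMap F _ (-m)) (hz0 : z ≠ 0)
    (hz : z * star z = algebraMap F _ m)
    (hyc : y * y = algebraMap F _ c) (hzc : z * z = algebraMap F _ c) : False := by
  have hym := mul_self_eq_of_anticommute_of_norm h2 hp hp0 hpy hy
  -- Here `z² = c = y² = m = z * star z`. Hence `z` is a scalar, commutes with `y`, and `(y - z)(y +
  -- z) = 0`, while `y` is pure.
  have hzz : star z = z := by
    have h1 : (star z - z) * star z = 0 := by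
      have := congrArg star (show z * z = z * star z by rw [hzc, ← hyc, hym, hz])
      rw [star_mul, star_mul, star_star] at this
      rw [sub_mul, this, sub_self]
    have hs : star z ≠ 0 := fun h => hz0 (star_eq_zero.mp h)
    exact sub_eq_zero.mp ((hQ.2 _ hs).mul_left_eq_zero.mp h1)
  have hz1 := eq_algebraMap_of_star_eq_self h2 hzz
  obtain ⟨r, hr⟩ : ∃ r, r = z.re := ⟨_, rfl⟩
  rw [← hr] at hz1
  have hyre := re_eq_zero_of_anticommute h2 hp hp0 hpy
  have hr0 : r ≠ 0 := by
    rintro rfl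
    exact hz0 (by rw [hz1, map_zero])
  have h3 : (y - z) * (y + z) = 0 := by
    have hcomm : z * y = y * z := by rw [hz1, Algebra.commutes]
    rw [sub_mul, mul_add, mul_add, hyc, hzc, hcomm]; abel
  by_cases h0 : y + z = 0
  · rw [hz1] at h0
    exact hr0 (by simpa [hyre] using congrArg QuaternionAlgebra.re h0)
  · have h4 := (hQ.2 _ h0).mul_left_eq_zero.mp h3
    rw [hz1] at h4
    exact hr0 (by simpa [hyre] using congrArg QuaternionAlgebra.re h4)

end PureSimilitudes

/-! ## Adjoint involutions -/

section AdjInvolution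

theorem diagonal_mul_adjInvolution {Q : Type*} [Ring Q] [StarRing Q] {n : ℕ} {w : Fin n → Q}
    (hw : ∀ i, IsUnit (w i)) (M : Matrix (Fin n) (Fin n) Q) :
    Matrix.diagonal w * adjInvolution w M = Mᴴ * Matrix.diagonal w := by
  have : Matrix.diagonal w * Matrix.diagonal (fun i => Ring.inverse (w i)) = 1 := by
    rw [Matrix.diagonal_mul_diagonal, ← Matrix.diagonal_one]
    exact congrArg _ (funext fun i => Ring.mul_inverse_cancel _ (hw i))
  rw [adjInvolution, ← mul_assoc, ← mul_assoc, this, one_mul]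

/-- With `H = diagonal w`, `(H M)ᴴ = -Mᴴ H = -H σ(M) = H M`. -/
theorem isHermitian_diagonal_mul_of_adjInvolution_eq_neg {Q : Type*} [Ring Q] [StarRing Q] {n : ℕ}
    {w : Fin n → Q} (hw : ∀ i, IsUnit (w i)) (hs : ∀ i, star (w i) = -w i)
    {M : Matrix (Fin n) (Fin n) Q} (hM : adjInvolution w M = -M) :
    (Matrix.diagonal w * M).IsHermitian := by
  have h := diagonal_mul_adjInvolution hw M
  have hd : (Matrix.diagonal w)ᴴ = -Matrix.diagonal w := by
    rw [Matrix.diagonal_conjTranspose, Matrix.diagonal_neg]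
    exact congrArg _ (funext hs)
  rw [hM, mul_neg] at h
  rw [Matrix.IsHermitian, Matrix.conjTranspose_mul, hd, mul_neg, ← h, neg_neg]

variable {K : Type u} [Field K] {a b : K} {n : ℕ}

/-- Two elements of the discriminant of a diagonal skew-hermitian form. -/
theorem RepresentsDisc.exists_sq_eq (h2 : (2 : K) ≠ 0) (hQ : IsDivisionAlg ℍ[K, a, b])
    {w : Fin n → ℍ[K, a, b]} (hw : ∀ i, IsUnit (w i)) (hs : ∀ i, star (w i) = -w i) {d : K}
    (hd : RepresentsDisc (adjInvolution w) d) :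
    ∃ r : K, (∏ i, (w i * star (w i)).re) * ((-1) ^ n * d) = r ^ 2 := by
  obtain ⟨-, x, -, hx, hn⟩ := hd
  obtain ⟨r, hr⟩ := exists_nrd_eq_sq_of_isHermitian h2 hQ
    (isHermitian_diagonal_mul_of_adjInvolution_eq_neg hw hs hx)
  rw [reducedNorm_eq_nrd] at hn
  rw [nrd_mul, hn, nrd_diagonal, ← map_mul] at hr
  have hinj : ∀ x y : K, algebraMap K (QuadraticAlgebra K a 0) x = algebraMap K _ y → x = y :=
    fun x y h => by simpa using congrArg QuadraticAlgebra.re h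
  exact ⟨r, hinj _ _ hr⟩

/-- On diagonal matrices whose entries commute with those of `w`, the adjoint involution is
entrywise conjugation, so pure entries give a skew-symmetric element. -/
theorem representsDisc_of_diagonal {w y : Fin n → ℍ[K, a, b]} (hw : ∀ i, IsUnit (w i))
    (hy : ∀ i, IsUnit (y i)) (hs : ∀ i, star (y i) = -y i) (hc : ∀ i, y i * w i = w i * y i)
    {d : K} (hd : d ≠ 0) (hyd : ∏ i, (y i * star (y i)).re = (-1) ^ n * d) :
    RepresentsDisc (adjInvolution w) d := by
  refine ⟨hd, Matrix.diagonal y, ?_, ?_, ?_⟩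
  · refine isUnit_iff_exists.mpr ⟨Matrix.diagonal fun i => Ring.inverse (y i), ?_, ?_⟩
    · rw [Matrix.diagonal_mul_diagonal, ← Matrix.diagonal_one]
      exact congrArg _ (funext fun i => Ring.mul_inverse_cancel _ (hy i))
    · rw [Matrix.diagonal_mul_diagonal, ← Matrix.diagonal_one]
      exact congrArg _ (funext fun i => Ring.inverse_mul_cancel _ (hy i))
  · rw [adjInvolution, Matrix.diagonal_conjTranspose, Matrix.diagonal_mul_diagonal,
      Matrix.diagonal_mul_diagonal, Matrix.diagonal_neg]
    refine congrArg _ (funext fun i => ?_)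
    rw [Pi.star_apply, hs, mul_neg, neg_mul, mul_assoc, hc, ← mul_assoc,
      Ring.inverse_mul_cancel _ (hw i), one_mul]
  · rw [reducedNorm_eq_nrd, nrd_diagonal, hyd]

end AdjInvolution

/-! ## The generic involution -/

section Generic

variable {F : Type u} {K : Type v} [Field F] [Field K] [Algebra F K] {α β : F}

theorem quatExtMap_eq_quatMap (x : ℍ[F, α, β]) :
    quatExtMap K α β x = quatMap (algebraMap F K) rfl rfl x := rfl

theorem quatExtMap_mul (x y : ℍ[F, α, β]) :
    quatExtMap K α β (x * y) = quatExtMap K α β x * quatExtMap K α β y := by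
  simp only [quatExtMap_eq_quatMap, map_mul]

theorem quatExtMap_neg (x : ℍ[F, α, β]) : quatExtMap K α β (-x) = -quatExtMap K α β x := by
  simp only [quatExtMap_eq_quatMap, map_neg]

theorem quatExtMap_algebraMap (c : F) :
    quatExtMap K α β (algebraMap F _ c) = algebraMap K _ (algebraMap F K c) := by
  ext <;> simp [quatExtMap]

theorem star_smul_quatExtMap_of_re_eq_zero (c : K) {x : ℍ[F, α, β]} (hx : x.re = 0) :
    star (c • quatExtMap K α β x) = -(c • quatExtMap K α β x) := by
  ext <;> simp [quatExtMap, hx]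

theorem norm_smul_quatExtMap (c : K) {x : ℍ[F, α, β]} {a : F} (hx : x.re = 0)
    (ha : x * x = algebraMap F _ a) :
    ((c • quatExtMap K α β x) * star (c • quatExtMap K α β x)).re = c ^ 2 * -algebraMap F K a := by
  rw [star_smul_quatExtMap_of_re_eq_zero c hx, mul_neg, smul_mul_smul_comm, ← quatExtMap_mul, ha,
    quatExtMap_algebraMap]
  simp [sq]

theorem isUnit_smul_quatExtMap {c : K} (hc : c ≠ 0) {x : ℍ[F, α, β]} {a : F}
    (ha : x * x = algebraMap F _ a) (ha0 : a ≠ 0) : IsUnit (c • quatExtMap K α β x) := by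
  have h : (c • quatExtMap K α β x) * (c • quatExtMap K α β x) =
      algebraMap K _ (c * c * algebraMap F K a) := by
    rw [smul_mul_smul_comm, ← quatExtMap_mul, ha, quatExtMap_algebraMap, map_mul (algebraMap K _)
      (c * c), Algebra.smul_def]
  have hu : IsUnit (algebraMap K (QuatExt K α β) (c * c * algebraMap F K a)) :=
    (isUnit_iff_ne_zero.mpr (mul_ne_zero (mul_ne_zero hc hc) ((map_ne_zero _).mpr ha0))).map _
  rw [← h] at hu
  exact (Commute.isUnit_mul_iff rfl).mp hu |>.1

/-- The last entry occurs `2 * k + 1` times, so padding changes the product only by a square. -/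
theorem prod_padSeq (a₁ a₂ a₃ : F) (k : ℕ) :
    ∏ i : Fin (2 * k + 3), padSeq a₁ a₂ a₃ (2 * k + 3) i = a₁ * a₂ * a₃ * (a₃ ^ k) ^ 2 := by
  rw [Fin.prod_univ_succ, Fin.prod_univ_succ, Fin.prod_univ_succ]
  have h : ∀ i : Fin (2 * k), padSeq a₁ a₂ a₃ (2 * k + 3) i.succ.succ.succ = a₃ := fun i => by
    simp [padSeq]
  have h0 : padSeq a₁ a₂ a₃ (2 * k + 3) 0 = a₁ := by simp [padSeq]
  have h1 : padSeq a₁ a₂ a₃ (2 * k + 3) (Fin.succ 0) = a₂ := by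
    simp only [padSeq, Fin.val_succ, Fin.val_zero]; norm_num
  have h2 : padSeq a₁ a₂ a₃ (2 * k + 3) (Fin.succ (Fin.succ 0)) = a₃ := by
    simp only [padSeq, Fin.val_succ, Fin.val_zero]; norm_num
  simp only [h, h0, h1, h2, Finset.prod_const, Finset.card_univ, Fintype.card_fin]
  ring

theorem padSeq_induction {X Y : Type*} {p : X → Y → Prop} {x₁ x₂ x₃ : X} {y₁ y₂ y₃ : Y}
    (h₁ : p x₁ y₁) (h₂ : p x₂ y₂) (h₃ : p x₃ y₃) (n : ℕ) (i : Fin n) :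
    p (padSeq x₁ x₂ x₃ n i) (padSeq y₁ y₂ y₃ n i) := by
  unfold padSeq
  split_ifs <;> assumption

/-- Write `d = s² A`. A square root `p` of `A` in `Q` anticommuting with some `b ≠ 0` gives `s p`, a
square root of `d` anticommuting with `b`, which yields both conclusions. -/
theorem isSplitBySqrt_quatExt (P : ResiduePlace (algebraMap F K)) (h2 : (2 : F) ≠ 0)
    (hQ : IsDivisionAlg ℍ[F, α, β]) {A : F} (hA : A ≠ 0) (h : IsSplitBySqrt F ℍ[F, α, β] A) {d : K}
    (hd : d ≠ 0) (hdA : IsSquare (d * algebraMap F K A)) :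
    ¬ IsSquare d ∧ IsSplitBySqrt K (QuatExt K α β) d := by
  obtain ⟨p, b, hp, hb, hpb⟩ := exists_sqrt_anticommute_of_isSplitBySqrt hQ h
  obtain ⟨e, he, hbe⟩ := mul_self_of_anticommute h2 hQ hA hp hb hpb
  obtain ⟨r, hr⟩ := hdA
  have h2K : (2 : K) ≠ 0 := by
    have := (map_ne_zero (algebraMap F K)).mpr h2
    rwa [map_ofNat] at this
  have hAK : algebraMap F K A ≠ 0 := (map_ne_zero _).mpr hA
  obtain ⟨s, hs, hds⟩ : ∃ s : K, s ≠ 0 ∧ d = s * s * algebraMap F K A := by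
    refine ⟨r / algebraMap F K A, div_ne_zero ?_ hAK, ?_⟩
    · rintro rfl
      exact mul_ne_zero hd hAK (by rw [hr, zero_mul])
    · field_simp
      linear_combination hr
  have hp' : (s • quatExtMap K α β p) * (s • quatExtMap K α β p) = algebraMap K _ d := by
    rw [smul_mul_smul_comm, ← quatExtMap_mul, hp, quatExtMap_algebraMap, hds, map_mul _ (s * s),
      Algebra.smul_def]
  have hb' : quatExtMap K α β b * quatExtMap K α β b = algebraMap K _ (algebraMap F K e) := by
    rw [← quatExtMap_mul, hbe, quatExtMap_algebraMap]
  have hpb' : (s • quatExtMap K α β p) * quatExtMap K α β b =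
      -(quatExtMap K α β b * (s • quatExtMap K α β p)) := by
    rw [smul_mul_assoc, mul_smul_comm, ← quatExtMap_mul, ← quatExtMap_mul, hpb, quatExtMap_neg,
      smul_neg]
  have heK : algebraMap F K e ≠ 0 := (map_ne_zero _).mpr he
  have hb0 : quatExtMap K α β b ≠ 0 := by
    intro h0
    rw [h0, zero_mul] at hb'
    exact heK ((map_eq_zero_iff _ QuaternionAlgebra.algebraMap_injective).mp hb'.symm)
  exact ⟨not_isSquare_of_sqrt_anticommute h2K (P.isDivisionAlg_quatExt hQ) hd hp' hb0 hpb',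
    isSplitBySqrt_of_anticommute h2K hd heK hp' hb' hpb'⟩

variable {n : ℕ} {t : Fin n → K} {q : Fin n → ℍ[F, α, β]} {a : Fin n → F}

/-- Reduction of improper similitudes of `⟨t₁q₁, …, tₙqₙ⟩`. -/
theorem IsImproperSimilitude.exists_residue (P : ResiduePlace (algebraMap F K))
    (hQ : IsDivisionAlg ℍ[F, α, β]) (hn : Odd n) (ht : ∀ i, t i ≠ 0)
    (ht2 : ∀ i j, i ≠ j → ∀ s, P.ring.valuation (t i * t j * s ^ 2) ≠ 1)
    (hq : ∀ i, q i * q i = algebraMap F _ (a i)) (ha : ∀ i, a i ≠ 0)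
    {g : Matrix (Fin n) (Fin n) (QuatExt K α β)}
    (hg : IsImproperSimilitude (adjInvolution fun i => t i • quatExtMap K α β (q i)) g) :
    ∃ (m : F) (x : Fin n → ℍ[F, α, β]), m ≠ 0 ∧ (∀ j, x j ≠ 0) ∧
      (∀ j, star (x j) * q j * x j = m • q j) ∧
      ∏ j, (x j * star (x j)).re = -m ^ Fintype.card (Fin n) ∧
      (IsSquareCentral g → ∃ c : F, ∀ j, x j * x j = algebraMap F _ c) := by
  obtain ⟨μ, ⟨-, hμ, hgμ⟩, hN⟩ := hg
  have hq0 : ∀ i, q i ≠ 0 := by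
    intro i hi
    have := hq i
    rw [hi, zero_mul] at this
    exact ha i ((map_eq_zero_iff _ QuaternionAlgebra.algebraMap_injective).mp this.symm)
  have hw : ∀ i, IsUnit (t i • quatExtMap K α β (q i)) := fun i =>
    isUnit_smul_quatExtMap (ht i) (hq i) (ha i)
  -- Only the diagonal entries of `gᴴ H g = μ H` are needed.
  have hcol : ∀ j, ∑ k, star (g k j) * (t k • quatExtMap K α β (q k)) * g k j =
      (μ * t j) • quatExtMap K α β (q j) := by
    intro j
    have h : Matrix.diagonal _ * adjInvolution _ g * g = gᴴ * Matrix.diagonal _ * g :=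
      congrArg (· * g) (diagonal_mul_adjInvolution hw g)
    rw [mul_assoc, hgμ] at h
    have h' := congrFun (congrFun h j) j
    rw [Matrix.diagonal_mul, Matrix.algebraMap_matrix_apply, if_pos rfl, Matrix.mul_apply,
      ← Algebra.commutes, ← Algebra.smul_def, smul_smul] at h'
    rw [h']
    refine Finset.sum_congr rfl fun k _ => ?_
    rw [Matrix.mul_diagonal, Matrix.conjTranspose_apply]
  obtain ⟨m, x, hm, hx, h1, h2, h3⟩ := P.exists_residue hQ (by rwa [Fintype.card_fin]) ht ht2 hq0
    hμ hcol
  refine ⟨m, x, hm, hx, h1, h2 ?_, h3⟩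
  rw [← reducedNorm_eq_nrd, hN, Fintype.card_fin]

end Generic

/-! ### The main theorem -/

theorem mainTheorem9 {F : Type u} [Field F] (hF : (2 : F) ≠ 0)
    (α β : F) (hQ : IsDivisionAlg ℍ[F, α, β])
    (q₁ q₂ q₃ : ℍ[F, α, β]) (a₁ a₂ a₃ : F)
    (hpure : q₁.re = 0 ∧ q₂.re = 0 ∧ q₃.re = 0)
    (ha : a₁ ≠ 0 ∧ a₂ ≠ 0 ∧ a₃ ≠ 0)
    (hsq : q₁ * q₁ = algebraMap F _ a₁ ∧ q₂ * q₂ = algebraMap F _ a₂ ∧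
      q₃ * q₃ = algebraMap F _ a₃)
    (hsplit : IsSplitBySqrt F ℍ[F, α, β] (a₁ * a₂ * a₃))
    (hμ : ¬ ∃ μ : F, μ ≠ 0 ∧ Nonempty (ℍ[F, α, β] ≃ₐ[F] ℍ[F, a₁, μ]) ∧
      Nonempty (ℍ[F, α, β] ≃ₐ[F] ℍ[F, a₂, μ]) ∧ Nonempty (ℍ[F, α, β] ≃ₐ[F] ℍ[F, a₃, μ]))
    (n : ℕ) (hn : 3 ≤ n) (hodd : Odd n) :
    (¬ ∃ g, IsImproperSimilitude (genericInvolution (padSeq q₁ q₂ q₃ n)) g ∧ IsSquareCentral g) ∧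
    (RepresentsDisc (genericInvolution (padSeq q₁ q₂ q₃ n))
        (algebraMap F (IterLaurent n F) (a₁ * a₂ * a₃)) ∧
      ∀ d : IterLaurent n F, RepresentsDisc (genericInvolution (padSeq q₁ q₂ q₃ n)) d →
        IsSquare (d * algebraMap F (IterLaurent n F) (a₁ * a₂ * a₃)) ∧ ¬ IsSquare d ∧
        IsSplitBySqrt (IterLaurent n F) (QuatExt (IterLaurent n F) α β) d) ∧
    ((¬ ∃ x : ℍ[F, α, β], x * star x = -1) →
      ¬ ∃ g, IsImproperSimilitude (genericInvolution (padSeq q₁ q₂ q₃ n)) g) := by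
  obtain ⟨k, rfl⟩ : ∃ k, n = 2 * k + 3 := by
    obtain ⟨l, hl⟩ := hodd
    exact ⟨l - 1, by omega⟩
  let n := 2 * k + 3
  let K := IterLaurent n F
  let P : ResiduePlace (algebraMap F K) := IterLaurent.place n F
  let t := IterLaurent.t n F
  let q := padSeq q₁ q₂ q₃ n
  let a := padSeq a₁ a₂ a₃ n
  have ht : ∀ i, t i ≠ 0 := IterLaurent.t_ne_zero n F
  have ht2 : ∀ i j, i ≠ j → ∀ s, P.ring.valuation (t i * t j * s ^ 2) ≠ 1 :=
    IterLaurent.valuation_t_mul_t_mul_sq_ne_one n F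
  have hq : ∀ i, q i * q i = algebraMap F _ (a i) :=
    padSeq_induction (p := fun x y => x * x = algebraMap F ℍ[F, α, β] y) hsq.1 hsq.2.1 hsq.2.2 n
  -- A property of a single sequence; the zero sequence is a dummy second argument.
  have hre : ∀ i, (q i).re = 0 := fun i =>
    padSeq_induction (p := fun (x : ℍ[F, α, β]) (_ : F) => x.re = 0) (y₁ := 0) (y₂ := 0) (y₃ := 0)
      hpure.1 hpure.2.1 hpure.2.2 n i
  have ha0 : ∀ i, a i ≠ 0 := fun i =>
    padSeq_induction (p := fun (x y : F) => x ≠ 0) (y₁ := (0 : F)) (y₂ := 0) (y₃ := 0)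
      ha.1 ha.2.1 ha.2.2 n i
  have hq0 : ∀ i, q i ≠ 0 := by
    intro i hi
    have := hq i
    rw [hi, zero_mul] at this
    exact ha0 i ((map_eq_zero_iff _ QuaternionAlgebra.algebraMap_injective).mp this.symm)
  have hmixed : ∀ g, IsImproperSimilitude (genericInvolution q) g →
      ∃ (m : F) (x : Fin n → ℍ[F, α, β]) (i j : Fin n), m ≠ 0 ∧ (∀ j, x j ≠ 0) ∧
        q i * x i = -(x i * q i) ∧ x i * star (x i) = algebraMap F _ (-m) ∧
        x j * star (x j) = algebraMap F _ m ∧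
        (IsSquareCentral g → ∃ c : F, ∀ j, x j * x j = algebraMap F _ c) := by
    intro g hg
    obtain ⟨m, x, hm, hx, h1, h2, h3⟩ := hg.exists_residue P hQ hodd ht ht2 hq ha0
    rcases nonempty_algEquiv_or_mixed hF hre hq ha0 hm hx h1 h2 with h | ⟨i, j, hi, hj⟩
    -- The indices `0`, `1`, `2` carry `a₁`, `a₂`, `a₃`, so the uniform case contradicts hypothesis
    -- (2) with `m` as the common slot.
    · exact absurd ⟨m, hm, h ⟨0, by omega⟩, h ⟨1, by omega⟩, h ⟨2, by omega⟩⟩ hμ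
    · exact ⟨m, x, i, j, hm, hx, hi.1, hi.2, hj, h3⟩
  refine ⟨?_, ⟨?_, ?_⟩, ?_⟩
  · rintro ⟨g, hg, hgc⟩
    obtain ⟨m, x, i, j, hm, hx, hi, hi', hj, h⟩ := hmixed g hg
    obtain ⟨c, hc⟩ := h hgc
    exact false_of_mixed_of_mul_self_eq hF hQ (hre i) (hq0 i) hi hi' (hx j) hj (hc i) (hc j)
  -- The factor `a₃⁻ᵏ` at one index holding `q₃` cancels the surplus square `(a₃ᵏ)²`, so that the
  -- representative is exactly `a₁a₂a₃`.
  · let s : Fin n → K := fun i => if i = 2 then algebraMap F K (a₃ ^ k)⁻¹ else 1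
    have hak : a₃ ^ k ≠ 0 := pow_ne_zero _ ha.2.2
    have hs : ∀ i, s i ≠ 0 := by
      intro i
      simp only [s]
      split_ifs
      · exact (map_ne_zero _).mpr (inv_ne_zero hak)
      · exact one_ne_zero
    refine representsDisc_of_diagonal (y := fun i => s i • quatExtMap K α β (q i))
      (fun i => isUnit_smul_quatExtMap (ht i) (hq i) (ha0 i))
      (fun i => isUnit_smul_quatExtMap (hs i) (hq i) (ha0 i))
      (fun i => star_smul_quatExtMap_of_re_eq_zero _ (hre i)) (fun i => ?_)
      ((map_ne_zero _).mpr (mul_ne_zero (mul_ne_zero ha.1 ha.2.1) ha.2.2)) ?_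
    · rw [smul_mul_smul_comm, smul_mul_smul_comm, mul_comm (s i)]
    · simp only [norm_smul_quatExtMap _ (hre _) (hq _), Finset.prod_mul_distrib, Finset.prod_neg,
        ← map_prod, s, ite_pow, one_pow, Finset.prod_ite_eq', Finset.mem_univ, if_true,
        Finset.card_univ, Fintype.card_fin]
      rw [prod_padSeq, ← map_pow, mul_left_comm, ← map_mul]
      congr 2
      field_simp
  · intro d hd
    have hw : ∀ i, IsUnit (t i • quatExtMap K α β (q i)) := fun i =>
      isUnit_smul_quatExtMap (ht i) (hq i) (ha0 i)
    have h2K : (2 : K) ≠ 0 := by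
      have := (map_ne_zero (algebraMap F K)).mpr hF
      rwa [map_ofNat] at this
    obtain ⟨r, hr⟩ := hd.exists_sq_eq h2K (P.isDivisionAlg_quatExt hQ) hw
      (fun i => star_smul_quatExtMap_of_re_eq_zero _ (hre i))
    have hA : a₁ * a₂ * a₃ ≠ 0 := mul_ne_zero (mul_ne_zero ha.1 ha.2.1) ha.2.2
    have hsquare : IsSquare (d * algebraMap F K (a₁ * a₂ * a₃)) := by
      simp only [norm_smul_quatExtMap _ (hre _) (hq _), Finset.prod_mul_distrib, Finset.prod_neg,
        ← map_prod, Finset.card_univ, Fintype.card_fin, Finset.prod_pow] at hr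
      have hT : ∏ i, t i ≠ 0 := Finset.prod_ne_zero_iff.mpr fun i _ => ht i
      have hak : algebraMap F K (a₃ ^ k) ≠ 0 := (map_ne_zero _).mpr (pow_ne_zero _ ha.2.2)
      rw [prod_padSeq, map_mul, map_pow] at hr
      have h1 : ((-1 : K) ^ n) * (-1) ^ n = 1 := by
        rw [← mul_pow, neg_mul_neg, one_mul, one_pow]
      -- The reduced norm of `H` is `(-1)ⁿ a₁a₂a₃` times the square of this denominator; the two
      -- signs `(-1)ⁿ` cancel.
      refine ⟨r / ((∏ i, t i) * algebraMap F K (a₃ ^ k)), ?_⟩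
      rw [div_mul_div_comm, eq_div_iff (mul_ne_zero (mul_ne_zero hT hak) (mul_ne_zero hT hak)),
        ← sq r, ← hr]
      linear_combination (-(d * algebraMap F K (a₁ * a₂ * a₃) * (∏ i, t i) ^ 2 *
        algebraMap F K (a₃ ^ k) ^ 2)) * h1
    exact ⟨hsquare, isSplitBySqrt_quatExt P hF hQ hA hsplit hd.1 hsquare⟩
  · rintro hneg ⟨g, hg⟩
    obtain ⟨m, x, i, j, hm, -, -, hi', hj, -⟩ := hmixed g hg
    exact hneg (exists_norm_eq_neg_one hm hi' hj)
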